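/- Let $K$ be an algebraically closed field of characteristic $0$ and let $\mathcal S=\operatorname{Spec} K[[X,Y,Z]]/(F)$ be an embedded algebroid surface of multiplicity $n\ge 1$, given by a Weierstrass equation $$F=Z^n+\sum_{k=0}^{n-2}a_k(X,Y)Z^k,\qquad a_k\in K[[X,Y]],\quad \operatorname{ord}(a_k)\ge n-k .$$ For a series $F'\in K[[X,Y,Z]]$ of order $n$ defining a surface $\mathcal S'$, put $\mathcal E(\mathcal S')=\{P\in\operatorname{Spec}K[[X,Y,Z]] : F'\in P^{(n)}\}$ (symbolic power), and let $\mathcal E_0(\mathcal S')$ be the set of those $P\in\mathcal E(\mathcal S')$ for which $K[[X,Y,Z]]/P$ is regular. Let $M=(X,Y,Z)$. By a curve we mean a prime $P$ with $\dim K[[X,Y,Z]]/P=1$. Let $\nu$ be the isomorphism $K[[X,Y,Z]]\to K[[X_1,Y_1,Z_1]]$ with $X\mapsto X_1$, $Y\mapsto Y_1$, $Z\mapsto Z_1$, and let $M_1=\nu(M)$. *Monoidal transforms.* Let $P=(Z,G)\in\mathcal E_0(\mathcal S)$ be a curve, $G\in K[[X,Y]]$. A monoidal transform of $\mathcal S$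 with center $P$ is a surface $\mathcal S^{(1)}$ with equation $F^{(1)}$ defined by $\pi(F)=G(X_1,Y_1)^nF^{(1)}$, where $\pi(X)=X_1$, $\pi(Y)=Y_1$, $\pi(Z)=G(X_1,Y_1)(Z_1+c)$ for some $c\in K$. *Quadratic transforms.* Let $\underline u=(u_1:u_2:u_3)\in\mathbf P^2(K)$ and choose an index $i$ with $u_i\neq0$. Write $x_1,x_2,x_3$ for $X,Y,Z$ and $y_1,y_2,y_3$ for $X_1,Y_1,Z_1$. Let $\pi(x_i)=y_i$ and $\pi(x_j)=y_i(y_j+u_j/u_i)$ for $j\ne i$. The quadratic transform $\mathcal S^{(1)}$ of $\mathcal S$ in $\underline u$ has equation $F^{(1)}$ defined by $\pi(F)=y_i^{\,n}F^{(1)}$. The exceptional divisor is $y_i=0$, and $(Z_1,y_i)$ is the prime of the exceptional divisor on the transform. For a prime $Q=(Z,G)$ with $0\ne G\in K[[X,Y]]$ put $\varpi_{\underline u}(Q)=\bigl(Z_1,\ \pi(G)/y_i^{\operatorname{ord}G}\bigr)$. We say that a curve $P$ is transversal to the exceptional divisor if $P+(y_i)=M_1$, and that a smooth curve $P$ is tangent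 to it if $y_i\in P+M_1^2$. **Theorem.** Let $\mathcal S^{(1)}$ be a quadratic or monoidal transform of $\mathcal S$ with the same multiplicity $n$. (a) If $\mathcal S^{(1)}$ is a monoidal transform with center a curve $P\in\mathcal E_0(\mathcal S)$, then either $\mathcal E_0(\mathcal S^{(1)})=\nu(\mathcal E_0(\mathcal S))$ or $\mathcal E_0(\mathcal S^{(1)})=\nu(\mathcal E_0(\mathcal S)\setminus\{P\})$. (b) Let $\mathcal S^{(1)}$ be the quadratic transform in $\underline u$. (b.1) If the tangent cone of $\mathcal S$ (the variety in $K^3$ defined by the initial form of $F$) is not a plane, then $\mathcal E_0(\mathcal S^{(1)})=\varpi_{\underline u}(\mathcal E_0(\mathcal S))$, with the convention $\varpi_{\underline u}(M)=M_1$; that is, $\mathcal E_0(\mathcal S^{(1)})=\{M_1\}\cup\{\varpi_{\underline u}(Q): Q\in\mathcal E_0(\mathcal S),\ Q\ne M\}$. (b.2) If the tangent cone of $\mathcal S$ is a plane, then every curve in $\mathcal E_0(\mathcal S^{(1)})$ is of one of the following types: (i) the exceptional divisor $(Z_1,y_i)$; (ii) a prime $\varpi_{\underline u}(Q)$ with $Q\in\mathcal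 E(\mathcal S)\setminus\mathcal E_0(\mathcal S)$ which is tangent to the exceptional divisor; (iii) a prime $\varpi_{\underline u}(Q)$ with $Q\in\mathcal E_0(\mathcal S)$, where both $\nu(Q)$ and $\varpi_{\underline u}(Q)$ are transversal to the exceptional divisor. Conversely, all primes of types (ii) and (iii) belong to $\mathcal E_0(\mathcal S^{(1)})$. Moreover, if there is a prime of type (ii), then the exceptional divisor $(Z_1,y_i)$ also belongs to $\mathcal E_0(\mathcal S^{(1)})$. -/

import Mathlib

namespace AlgebroidSurface

open MvPowerSeries

/-- The ring `K[[X,Y,Z]]`, with `X = X 0`, `Y = X 1`, `Z = X 2`. The same ring serves as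
`K[[X₁,Y₁,Z₁]]`, so that the isomorphism `ν` (`X ↦ X₁`, `Y ↦ Y₁`, `Z ↦ Z₁`) is the identity. -/
abbrev PS (K : Type*) [Field K] : Type _ := MvPowerSeries (Fin 3) K

variable {K : Type*} [Field K]

/-- The power series lies in the subring `K[[X,Y]]`: the variable `Z` does not occur in it. -/
def InXY (f : PS K) : Prop := ∀ d : Fin 3 →₀ ℕ, d 2 ≠ 0 → coeff d f = 0

/-- `F = Z ^ n + ∑_{k ≤ n-2} a_k(X,Y) Z ^ k` with `n ≥ 1` and `ord a_k ≥ n - k`: a Weierstrass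
equation of multiplicity `n`. -/
def IsWeierstrassEquation (n : ℕ) (F : PS K) : Prop :=
  1 ≤ n ∧ ∃ a : ℕ → PS K,
    (∀ k ∈ Finset.range (n - 1), InXY (a k) ∧ ((n - k : ℕ) : ℕ∞) ≤ (a k).order) ∧
    F = X 2 ^ n + ∑ k ∈ Finset.range (n - 1), a k * X 2 ^ k

/-- The multiplicity (at the origin) of the surface `F = 0`. -/
noncomputable def mult (F : PS K) : ℕ := F.order.toNat

/-- The initial form of `F`, as a polynomial. -/
noncomputable def initialForm (F : PS K) : MvPolynomial (Fin 3) K :=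
  truncTotal (mult F + 1) (homogeneousComponent (mult F) F)

/-- The tangent cone: the affine variety in `K³` defined by the initial form. -/
noncomputable def tangentCone (F : PS K) : Set (Fin 3 → K) :=
  {v | MvPolynomial.eval v (initialForm F) = 0}

/-- The tangent cone of the surface is a plane. -/
def TangentConeIsPlane (F : PS K) : Prop :=
  ∃ W : Submodule K (Fin 3 → K), Module.finrank K W = 2 ∧ (W : Set (Fin 3 → K)) = tangentCone F

/-- The ideal `M = (X,Y,Z)`, i.e. the closed point. -/
noncomputable def M (K : Type*) [Field K] : Ideal (PS K) := Ideal.span {X 0, X 1, X 2}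

/-- The symbolic power `P^(n)` of a prime ideal: the contraction of `P ^ n R_P`. -/
noncomputable def symbolicPower {R : Type*} [CommRing R] (P : Ideal R) [P.IsPrime] (n : ℕ) :
    Ideal R :=
  ((P ^ n).map (algebraMap R (Localization.AtPrime P))).comap
    (algebraMap R (Localization.AtPrime P))

/-- The equimultiple locus `E(S)` of the surface `F = 0`. -/
def equimultipleLocus (F : PS K) : Set (Ideal (PS K)) :=
  {P | ∃ _ : P.IsPrime, F ∈ symbolicPower P (mult F)}

/-- The smooth equimultiple locus `E₀(S)`: the elements `P` of `E(S)` such that the subscheme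
defined by `P` is regular. -/
def smoothLocus (F : PS K) : Set (Ideal (PS K)) :=
  {P | P ∈ equimultipleLocus F ∧ IsRegularLocalRing (PS K ⧸ P)}

/-- The prime `P` defines a curve. (If the surface is not `Z ^ n = 0`, then every element of its
equimultiple locus other than `M` is a curve; for `Z ^ n` the locus also contains `(Z)`.) -/
def IsCurve (P : Ideal (PS K)) : Prop := ringKrullDim (PS K ⧸ P) = 1

/-- Substitution for the blow-up of the curve `(Z, G)`, at the point with parameter `c = γ/α` of
the fibre over the origin:
`X ↦ X₁`, `Y ↦ Y₁`, `Z ↦ G(X₁,Y₁) (Z₁ + c)`. For `G = X` these are the usual equations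
at the direction `(α : 0 : γ)`. -/
noncomputable def monoidalSubst (G : PS K) (c : K) : Fin 3 → PS K :=
  ![X 0, X 1, G * (X 2 + C c)]

lemma hasSubst_monoidalSubst (G : PS K) (hG : constantCoeff G = 0) (c : K) :
    HasSubst (monoidalSubst G c) := by
  apply hasSubst_of_constantCoeff_zero
  intro j
  fin_cases j <;> simp [monoidalSubst, hG]

/-- `F₁` is an equation of a monoidal transform, with center the curve `P = (Z, G)`, of the
surface `F = 0`; it is determined by `π(F) = G ^ mult F * F₁`. The one point of the fibre over the
origin that is not of this form, the direction `(0 : 0 : 1)`, never lies on the transform of a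
surface given by a Weierstrass equation. -/
def IsMonoidalTransform (P : Ideal (PS K)) (F F₁ : PS K) : Prop :=
  ∃ (G : PS K) (c : K), InXY G ∧ P = Ideal.span {X 2, G} ∧
    subst (monoidalSubst G c) F = G ^ mult F * F₁

/-- Equations of the quadratic transformation at the direction `u = (u 0 : u 1 : u 2)`, where the
coordinate `u i ≠ 0` is privileged: `X i ↦ X i` and `X j ↦ X i * (X j + u j / u i)` for `j ≠ i`.
The exceptional divisor is `X i = 0`. -/
noncomputable def quadSubst (u : Fin 3 → K) (i : Fin 3) : Fin 3 → PS K :=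
  fun j => if j = i then X i else X i * (X j + C (u j / u i))

lemma hasSubst_quadSubst (u : Fin 3 → K) (i : Fin 3) : HasSubst (quadSubst u i) := by
  apply hasSubst_of_constantCoeff_zero
  intro j
  unfold quadSubst
  split_ifs <;> simp

/-- `F₁` is the equation of the quadratic transform of `F = 0` in the point `u`, written in the
coordinates where `u i ≠ 0` is privileged: `π(F) = X i ^ mult F * F₁`. -/
def IsQuadraticTransform (u : Fin 3 → K) (i : Fin 3) (F F₁ : PS K) : Prop :=
  subst (quadSubst u i) F = X i ^ mult F * F₁

/-- `P` is the quadratic transform of `Q = (Z, G(X,Y))` in the point `u`, i.e. the ideal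
`(Z₁, π(G) / X i ^ ord G)` (which may be the unit ideal). It does not depend on the choice of the
generator `G`. -/
def IsQuadraticTransformIdeal (u : Fin 3 → K) (i : Fin 3) (Q P : Ideal (PS K)) : Prop :=
  ∃ G G₁ : PS K, InXY G ∧ G ≠ 0 ∧ Q = Ideal.span {X 2, G} ∧
    subst (quadSubst u i) G = X i ^ G.order.toNat * G₁ ∧ P = Ideal.span {X 2, G₁}

/-- The curve cut out on the transform by the exceptional divisor `X i = 0`. -/
noncomputable def exceptionalCurve (i : Fin 3) : Ideal (PS K) := Ideal.span {X 2, X i}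

/-- The (smooth) curve `P` is tangent to the divisor `X i = 0`: the linear form `X i` vanishes on
the tangent space of `P` at the closed point. -/
def IsTangent (i : Fin 3) (P : Ideal (PS K)) : Prop := X i ∈ P ⊔ M K ^ 2

/-- The curve `P` is transversal to the divisor `X i = 0`: their scheme-theoretic intersection is
the reduced closed point. A smooth curve is transversal if and only if it is not tangent. -/
def IsTransversal (i : Fin 3) (P : Ideal (PS K)) : Prop := P ⊔ Ideal.span {X i} = M K

/-- `P` is a prime `ϖ_u(Q)`, with `Q ∈ E(S) \ E₀(S)`, tangent to the exceptional divisor. -/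
def IsTypeTwo (u : Fin 3 → K) (i : Fin 3) (F : PS K) (P : Ideal (PS K)) : Prop :=
  P.IsPrime ∧ IsTangent i P ∧
    ∃ Q ∈ equimultipleLocus F \ smoothLocus F, IsQuadraticTransformIdeal u i Q P

/-- `P` is a prime `ϖ_u(Q)`, with `Q ∈ E₀(S)`, where `ν(Q)` and `ϖ_u(Q)` are both transversal to
the exceptional divisor. -/
def IsTypeThree (u : Fin 3 → K) (i : Fin 3) (F : PS K) (P : Ideal (PS K)) : Prop :=
  P.IsPrime ∧ IsTransversal i P ∧
    ∃ Q ∈ smoothLocus F, IsTransversal i Q ∧ IsQuadraticTransformIdeal u i Q P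

end AlgebroidSurface

/-! The equation has no term in `Z ^ (n - 1)` and the characteristic is `0`, so repeated use of
`∂/∂Z` shows that `F ∈ P^(n)` if and only if `Z ∈ P` and `a_k ∈ P^(n-k)` for every `k`
(`weierstrass_mem_symbolicPower_iff`). For `P = (Z, G)` this says that `G ^ (n - k)` divides `a_k`,
and for `P = M` it says that `ord a_k ≥ n - k`. The second reading, applied to a transform written
in powers of `Z + c`, shows that equal multiplicity forces `c = 0`: the transform is again a
Weierstrass equation, with coefficients `π(a_k)` divided by `G ^ (n - k)` or `X i ^ (n - k)`
(`hasWeierstrassCoeffs_of_le_order`). The chart `i = 2` cannot occur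
(`not_isQuadraticTransform_two`).

For a monoidal transform, `G` becomes a unit at every prime containing `Z` other than `P` and `M`,
so only the membership of `P` can change.

For a quadratic transform, let `(Z, H)` be a curve of the new locus with `X i ∤ H`. Weierstrass
preparation replaces `H` by a distinguished polynomial of some degree `m` in `X j`. Homogenizing it
gives `G` of order `m` with `π(G) = X i ^ m * H`, and division by `G` shows that divisibility by
powers of `H` descends to divisibility by powers of `G` (`exists_blowDown`,
`pow_dvd_of_pow_dvd_quadHom`). Hence `(Z, G)` is equimultiple on the original surface. If `m = 1`
both curves are smooth and transversal; if `m ≥ 2` then `(Z, G)` is singular and `H` is tangent to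
the exceptional divisor. Conversely, if `ord G = s` and `π(G) = X i ^ s * G₁`, then the `k`-th new
coefficient is divisible by `X i ^ ((n - k) * (s - 1)) * G₁ ^ (n - k)`, which puts `(Z, G₁)` in the
locus and, for `s ≥ 2`, also the exceptional divisor.

If the tangent cone is not a plane, some `a_k` has order exactly `n - k`, and its transform contains
the monomial `X j ^ (n - k)` (`coeff_ne_zero_of_quadHom_eq`). This excludes the exceptional divisor
and forces every order above to be `1`. -/

namespace AlgebroidSurface

open MvPowerSeries

variable {K : Type*} [Field K]

/-! ### The subring `K[[X,Y]]`. -/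

section InXY

lemma InXY.add {f g : PS K} (hf : InXY f) (hg : InXY g) : InXY (f + g) := fun d hd => by
  rw [map_add, hf d hd, hg d hd, add_zero]

lemma InXY.neg {f : PS K} (hf : InXY f) : InXY (-f) := fun d hd => by
  rw [map_neg, hf d hd, neg_zero]

lemma InXY.sub {f g : PS K} (hf : InXY f) (hg : InXY g) : InXY (f - g) := by
  rw [sub_eq_add_neg]; exact hf.add hg.neg

lemma InXY.mul {f g : PS K} (hf : InXY f) (hg : InXY g) : InXY (f * g) := fun d hd => by
  classical
  rw [coeff_mul]
  refine Finset.sum_eq_zero fun p hp => ?_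
  rw [Finset.HasAntidiagonal.mem_antidiagonal] at hp
  by_cases h : p.1 2 = 0
  · rw [hg p.2, mul_zero]
    rw [← hp, Finsupp.add_apply, h, zero_add] at hd
    exact hd
  · rw [hf p.1 h, zero_mul]

lemma inXY_C (c : K) : InXY (C c : PS K) := fun d hd => by
  classical
  rw [coeff_C, if_neg]
  rintro rfl
  exact hd rfl

lemma inXY_X {s : Fin 3} (hs : s ≠ 2) : InXY (X s : PS K) := fun d hd => by
  classical
  rw [coeff_X, if_neg]
  rintro rfl
  exact hd (Finsupp.single_eq_of_ne (Ne.symm hs))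

/-- The subring `K[[X,Y]]` of `K[[X,Y,Z]]`. -/
def xySubring (K : Type*) [Field K] : Subring (PS K) where
  carrier := {f | InXY f}
  mul_mem' := InXY.mul
  one_mem' := inXY_C 1
  add_mem' := InXY.add
  zero_mem' := fun _ _ => map_zero _
  neg_mem' := InXY.neg

lemma InXY.pow {f : PS K} (hf : InXY f) (n : ℕ) : InXY (f ^ n) :=
  (xySubring K).pow_mem hf n

lemma InXY.sum {ι : Type*} {s : Finset ι} {f : ι → PS K} (h : ∀ k ∈ s, InXY (f k)) :
    InXY (∑ k ∈ s, f k) :=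
  (xySubring K).sum_mem h

lemma InXY.of_mul_X_pow {f : PS K} {s : Fin 3} (hs : s ≠ 2) {n : ℕ} (h : InXY (X s ^ n * f)) :
    InXY f := fun d hd => by
  have := h (Finsupp.single s n + d) (by
    rwa [Finsupp.add_apply, Finsupp.single_eq_of_ne (Ne.symm hs), zero_add])
  rwa [X_pow_eq, coeff_add_monomial_mul, one_mul] at this

lemma InXY.pderiv {f : PS K} (hf : InXY f) : MvPowerSeries.pderiv K 2 f = 0 := by
  ext d
  rw [coeff_pderiv, hf, zero_mul, map_zero]
  simp

end InXY

/-- `{i, j} = {0, 1}`: the variables `X i` and `X j` are, in some order, `X` and `Y`. -/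
def IsXYPair (i j : Fin 3) : Prop := i ≠ j ∧ i ≠ 2 ∧ j ≠ 2

/-! ### Setting `Z = 0`, and `K[[X,Y]]` as the iterated ring `K[[X i]][[X j]]`, in which Weierstrass
division takes place. -/

section Restriction

variable {i j : Fin 3}

lemma IsXYPair.cases (h : IsXYPair i j) (s : Fin 3) : s = i ∨ s = j ∨ s = 2 := by
  obtain ⟨h1, h2, h3⟩ := h
  omega

lemma IsXYPair.finsupp_ext (h : IsXYPair i j) {d e : Fin 3 →₀ ℕ} (hi : d i = e i)
    (hj : d j = e j) (h2 : d 2 = e 2) : d = e := by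
  ext s
  rcases h.cases s with rfl | rfl | rfl <;> assumption

lemma IsXYPair.degree (h : IsXYPair i j) (d : Fin 3 →₀ ℕ) :
    d.degree = d i + d j + d 2 := by
  obtain ⟨h1, h2, h3⟩ := h
  rw [Finsupp.degree_eq_sum, Fin.sum_univ_three]
  fin_cases i <;> fin_cases j <;> (simp_all; try omega)

/-- The exponent of `X i ^ a * X j ^ b`. -/
noncomputable def xyExp (i j : Fin 3) (a b : ℕ) : Fin 3 →₀ ℕ :=
  Finsupp.single i a + Finsupp.single j b

lemma IsXYPair.xyExp_fst (h : IsXYPair i j) (a b : ℕ) : xyExp i j a b i = a := by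
  simp [xyExp, Finsupp.single_eq_of_ne h.1]

lemma IsXYPair.xyExp_snd (h : IsXYPair i j) (a b : ℕ) : xyExp i j a b j = b := by
  simp [xyExp, Finsupp.single_eq_of_ne h.1.symm]

lemma IsXYPair.xyExp_two (h : IsXYPair i j) (a b : ℕ) : xyExp i j a b 2 = 0 := by
  simp [xyExp, Finsupp.single_eq_of_ne h.2.1.symm, Finsupp.single_eq_of_ne h.2.2.symm]

lemma IsXYPair.eq_xyExp (h : IsXYPair i j) {d : Fin 3 →₀ ℕ} (hd : d 2 = 0) :
    d = xyExp i j (d i) (d j) :=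
  h.finsupp_ext (h.xyExp_fst _ _).symm (h.xyExp_snd _ _).symm (hd.trans (h.xyExp_two _ _).symm)

/-- Setting `Z = 0`, as a ring homomorphism to `K[[X i]][[X j]]`. -/
noncomputable def restrict (h : IsXYPair i j) : PS K →+* PowerSeries (PowerSeries K) where
  toFun f := PowerSeries.mk fun b => PowerSeries.mk fun a => coeff (xyExp i j a b) f
  map_zero' := by ext; simp
  map_add' _ _ := by ext; simp
  map_one' := by
    classical
    ext b a
    rw [PowerSeries.coeff_mk, PowerSeries.coeff_mk, coeff_one, PowerSeries.coeff_one]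
    have : xyExp i j a b = 0 ↔ b = 0 ∧ a = 0 := by
      refine ⟨fun e => ⟨?_, ?_⟩, ?_⟩
      · rw [← h.xyExp_snd a b, e]; rfl
      · rw [← h.xyExp_fst a b, e]; rfl
      · rintro ⟨rfl, rfl⟩; simp [xyExp]
    simp only [this]
    by_cases hb : b = 0 <;> by_cases ha : a = 0 <;> simp [ha, hb, PowerSeries.coeff_one]
  map_mul' f g := by
    classical
    ext b a
    rw [PowerSeries.coeff_mk, PowerSeries.coeff_mk, coeff_mul, PowerSeries.coeff_mul, map_sum]
    simp_rw [PowerSeries.coeff_mul, PowerSeries.coeff_mk, Finset.sum_sigma']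
    -- Both parts of a decomposition of an exponent without `Z` are again without `Z`, so the
    -- antidiagonal is the product of the antidiagonals in `X i` and `X j`.
    refine Finset.sum_bij' (fun p _ => ⟨(p.1 j, p.2 j), (p.1 i, p.2 i)⟩)
      (fun q _ => (xyExp i j q.2.1 q.1.1, xyExp i j q.2.2 q.1.2)) ?_ ?_ ?_ ?_ ?_
    · intro p hp
      rw [Finset.HasAntidiagonal.mem_antidiagonal] at hp
      simp only [Finset.mem_sigma, Finset.HasAntidiagonal.mem_antidiagonal, ← Finsupp.add_apply, hp]
      exact ⟨h.xyExp_snd _ _, h.xyExp_fst _ _⟩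
    · rintro ⟨⟨b1, b2⟩, ⟨a1, a2⟩⟩ hq
      simp only [Finset.mem_sigma, Finset.HasAntidiagonal.mem_antidiagonal] at hq ⊢
      rw [← hq.1, ← hq.2]
      simp only [xyExp, Finsupp.single_add]
      abel
    · intro p hp
      rw [Finset.HasAntidiagonal.mem_antidiagonal] at hp
      have h2 : p.1 2 + p.2 2 = 0 := by rw [← Finsupp.add_apply, hp, h.xyExp_two]
      exact Prod.ext (h.eq_xyExp (by omega)).symm (h.eq_xyExp (by omega)).symm
    · rintro ⟨⟨b1, b2⟩, ⟨a1, a2⟩⟩ _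
      simp [h.xyExp_fst, h.xyExp_snd]
    · intro p hp
      rw [Finset.HasAntidiagonal.mem_antidiagonal] at hp
      have h2 : p.1 2 + p.2 2 = 0 := by rw [← Finsupp.add_apply, hp, h.xyExp_two]
      rw [← h.eq_xyExp (d := p.1) (by omega), ← h.eq_xyExp (d := p.2) (by omega)]

lemma coeff_coeff_restrict (h : IsXYPair i j) (f : PS K) (a b : ℕ) :
    PowerSeries.coeff a (PowerSeries.coeff b (restrict h f)) = coeff (xyExp i j a b) f := by
  simp [restrict]

/-- A series in `K[[X i]][[X j]]` as a series in `K[[X,Y,Z]]`, as a function. -/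
noncomputable def extendFun (i j : Fin 3) (g : PowerSeries (PowerSeries K)) : PS K := fun d =>
  if d 2 = 0 then PowerSeries.coeff (d i) (PowerSeries.coeff (d j) g) else 0

lemma coeff_extendFun (i j : Fin 3) (g : PowerSeries (PowerSeries K)) (d : Fin 3 →₀ ℕ) :
    coeff d (extendFun i j g) =
      if d 2 = 0 then PowerSeries.coeff (d i) (PowerSeries.coeff (d j) g) else 0 := rfl

lemma inXY_extendFun (g : PowerSeries (PowerSeries K)) : InXY (extendFun i j g) := fun d hd => by
  rw [coeff_extendFun, if_neg hd]

lemma restrict_extendFun (h : IsXYPair i j) (g : PowerSeries (PowerSeries K)) :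
    restrict h (extendFun i j g) = g := by
  ext b a
  rw [coeff_coeff_restrict, coeff_extendFun, if_pos (h.xyExp_two _ _), h.xyExp_fst, h.xyExp_snd]

lemma InXY.restrict_injective (h : IsXYPair i j) {f g : PS K} (hf : InXY f) (hg : InXY g)
    (e : restrict h f = restrict h g) : f = g := by
  ext d
  by_cases hd : d 2 = 0
  · rw [h.eq_xyExp hd, ← coeff_coeff_restrict h, e, coeff_coeff_restrict]
  · rw [hf d hd, hg d hd]

/-- The inclusion of `K[[X i]][[X j]]` in `K[[X,Y,Z]]`. -/
noncomputable def extend (h : IsXYPair i j) : PowerSeries (PowerSeries K) →+* PS K where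
  toFun := extendFun i j
  -- Each ring axiom is checked after `restrict`, which is injective on series without `Z`.
  map_zero' := (inXY_extendFun _).restrict_injective h (xySubring K).zero_mem
    (by rw [restrict_extendFun, map_zero])
  map_one' := (inXY_extendFun _).restrict_injective h (xySubring K).one_mem
    (by rw [restrict_extendFun, map_one])
  map_add' f g := (inXY_extendFun _).restrict_injective h
    ((inXY_extendFun _).add (inXY_extendFun _)) (by simp only [restrict_extendFun, map_add])
  map_mul' f g := (inXY_extendFun _).restrict_injective h
    ((inXY_extendFun _).mul (inXY_extendFun _)) (by simp only [restrict_extendFun, map_mul])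

variable (h : IsXYPair i j)

lemma coeff_extend (g : PowerSeries (PowerSeries K)) (d : Fin 3 →₀ ℕ) :
    coeff d (extend h g) =
      if d 2 = 0 then PowerSeries.coeff (d i) (PowerSeries.coeff (d j) g) else 0 := rfl

lemma inXY_extend (g : PowerSeries (PowerSeries K)) : InXY (extend h g) := inXY_extendFun g

@[simp] lemma restrict_extend (g : PowerSeries (PowerSeries K)) : restrict h (extend h g) = g :=
  restrict_extendFun h g

lemma InXY.extend_restrict {f : PS K} (hf : InXY f) : extend h (restrict h f) = f :=
  (inXY_extend h _).restrict_injective h hf (restrict_extend h _)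

@[simp] lemma extend_C_X : extend h (PowerSeries.C PowerSeries.X) = (X i : PS K) := by
  classical
  ext d
  rw [coeff_extend, coeff_X, PowerSeries.coeff_C]
  have : d = Finsupp.single i 1 ↔ d 2 = 0 ∧ d j = 0 ∧ d i = 1 := by
    constructor
    · rintro rfl
      simp [Finsupp.single_eq_of_ne h.1.symm, Finsupp.single_eq_of_ne h.2.1.symm]
    · rintro ⟨h2, hj, hi⟩
      apply h.finsupp_ext <;>
      simp [Finsupp.single_eq_of_ne h.1.symm, Finsupp.single_eq_of_ne h.2.1.symm, *]
  by_cases h2 : d 2 = 0 <;> by_cases hj : d j = 0 <;>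
    simp [this, h2, hj, PowerSeries.coeff_X]

@[simp] lemma extend_X : extend h PowerSeries.X = (X j : PS K) := by
  classical
  ext d
  rw [coeff_extend, coeff_X, PowerSeries.coeff_X]
  have : d = Finsupp.single j 1 ↔ d 2 = 0 ∧ d j = 1 ∧ d i = 0 := by
    constructor
    · rintro rfl
      simp [Finsupp.single_eq_of_ne h.1, Finsupp.single_eq_of_ne h.2.2.symm]
    · rintro ⟨h2, hj, hi⟩
      apply h.finsupp_ext <;>
      simp [Finsupp.single_eq_of_ne h.1, Finsupp.single_eq_of_ne h.2.2.symm, *]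
  by_cases h2 : d 2 = 0 <;> by_cases hj : d j = 1 <;>
    simp [this, h2, hj, PowerSeries.coeff_one]

@[simp] lemma extend_C_C (c : K) : extend h (PowerSeries.C (PowerSeries.C c)) = (C c : PS K) := by
  classical
  ext d
  rw [coeff_extend, coeff_C, PowerSeries.coeff_C]
  have : d = 0 ↔ d 2 = 0 ∧ d j = 0 ∧ d i = 0 := by
    constructor
    · rintro rfl
      simp
    · rintro ⟨h2, hj, hi⟩
      apply h.finsupp_ext <;> simp [*]
  by_cases h2 : d 2 = 0 <;> by_cases hj : d j = 0 <;>
    simp [this, h2, hj, PowerSeries.coeff_C]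

@[simp] lemma restrict_X_fst : restrict h (X i : PS K) = PowerSeries.C PowerSeries.X := by
  rw [← extend_C_X h, restrict_extend]

@[simp] lemma restrict_X_snd : restrict h (X j : PS K) = PowerSeries.X := by
  rw [← extend_X h, restrict_extend]

@[simp] lemma restrict_X_two : restrict h (X 2 : PS K) = 0 := by
  classical
  ext b a
  rw [coeff_coeff_restrict, coeff_X, if_neg]
  · simp
  · intro e
    simpa [h.xyExp_two] using congrArg (fun d => d 2) e

lemma X_two_dvd_of_restrict_eq_zero {f : PS K} (hf : restrict h f = 0) : X 2 ∣ f := by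
  rw [X_dvd_iff]
  intro d hd
  rw [h.eq_xyExp hd, ← coeff_coeff_restrict h, hf]
  simp

lemma X_two_dvd_sub (f : PS K) : X 2 ∣ f - extend h (restrict h f) :=
  X_two_dvd_of_restrict_eq_zero h (by simp)

/-- A series differs from the extension of its restriction by a multiple of `Z`, so ideals `(Z, G)`
reduce to divisibility in two variables. -/
lemma mem_span_pair_iff {G : PS K} (f : PS K) (hG : InXY G) :
    f ∈ Ideal.span {X 2, G} ↔ restrict h G ∣ restrict h f := by
  rw [Ideal.mem_span_pair]
  constructor
  · rintro ⟨a, b, rfl⟩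
    exact ⟨restrict h b, by simp [mul_comm]⟩
  · rintro ⟨b, hb⟩
    obtain ⟨q, hq⟩ := X_two_dvd_sub h f
    refine ⟨q, extend h b, ?_⟩
    rw [hb, map_mul, hG.extend_restrict] at hq
    linear_combination -hq

lemma InXY.dvd_iff {f g : PS K} (hf : InXY f) (hg : InXY g) :
    restrict h f ∣ restrict h g ↔ f ∣ g := by
  refine ⟨fun e => ?_, map_dvd _⟩
  have := map_dvd (extend h) e
  rwa [hf.extend_restrict, hg.extend_restrict] at this

end Restriction

lemma isXYPair_zero_one : IsXYPair 0 1 := by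
  refine ⟨?_, ?_, ?_⟩ <;> decide

lemma InXY.mem_span_pair_iff {f G : PS K} (hf : InXY f) (hG : InXY G) :
    f ∈ Ideal.span {X 2, G} ↔ G ∣ f := by
  rw [AlgebroidSurface.mem_span_pair_iff isXYPair_zero_one f hG, hG.dvd_iff _ hf]

/-- The quotient of two elements of `K[[X,Y]]` is in `K[[X,Y]]`. -/
lemma InXY.exists_eq_mul_of_dvd {f g : PS K} (hf : InXY f) (hg : InXY g) (hfg : f ∣ g) :
    ∃ q, InXY q ∧ g = f * q := by
  obtain ⟨q, hq⟩ := (hf.dvd_iff isXYPair_zero_one hg).mpr hfg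
  refine ⟨extend isXYPair_zero_one q, inXY_extend _ _, ?_⟩
  have := congrArg (extend isXYPair_zero_one) hq
  rwa [map_mul, hf.extend_restrict, hg.extend_restrict] at this

/-! ### Powers of `M` and the order of a series. -/

section MaximalIdeal

/-- The series `g` such that `f - X s * g` does not involve the variable `X s`. -/
noncomputable def divX (s : Fin 3) (f : PS K) : PS K := fun d => coeff (d + Finsupp.single s 1) f

lemma coeff_divX (s : Fin 3) (f : PS K) (d : Fin 3 →₀ ℕ) :
    coeff d (divX s f) = coeff (d + Finsupp.single s 1) f := rfl

lemma coeff_sub_X_mul_divX (s : Fin 3) (f : PS K) (d : Fin 3 →₀ ℕ) :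
    coeff d (f - X s * divX s f) = if d s = 0 then coeff d f else 0 := by
  rw [map_sub, X, coeff_monomial_mul, one_mul]
  by_cases hd : d s = 0
  · rw [if_pos hd, if_neg, sub_zero]
    intro hle
    have := hle s
    rw [Finsupp.single_eq_same, hd] at this
    omega
  · have hle : Finsupp.single s 1 ≤ d := by
      rw [Finsupp.single_le_iff]; omega
    rw [if_neg hd, if_pos hle, coeff_divX, tsub_add_cancel_of_le hle, sub_self]

lemma le_order_divX (s : Fin 3) {f : PS K} {n : ℕ} (hf : ((n + 1 : ℕ) : ℕ∞) ≤ f.order) :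
    (n : ℕ∞) ≤ (divX s f).order := by
  refine nat_le_order fun d hd => ?_
  rw [coeff_divX]
  refine coeff_of_lt_order (lt_of_lt_of_le ?_ hf)
  rw [map_add, Finsupp.degree_single]
  exact_mod_cast Nat.succ_lt_succ hd

lemma le_order_sub_X_mul_divX (s : Fin 3) {f : PS K} {n : ℕ∞} (hf : n ≤ f.order) :
    n ≤ (f - X s * divX s f).order := by
  refine hf.trans (le_order fun d hd => ?_)
  rw [coeff_sub_X_mul_divX, coeff_of_lt_order hd, ite_self]

/-- The variables `Z`, `Y`, `X` are split off in turn. Each quotient loses at most one in order and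
each remainder loses nothing; this gives the induction step for `mem_M_pow_iff`. -/
lemma exists_eq_sum_X_mul (f : PS K) : ∃ g : Fin 3 → PS K,
    f = X 0 * g 0 + X 1 * g 1 + X 2 * g 2 + C (constantCoeff f) ∧
      ∀ n : ℕ, ((n + 1 : ℕ) : ℕ∞) ≤ f.order → ∀ s, (n : ℕ∞) ≤ (g s).order := by
  classical
  set f1 := f - X 2 * divX 2 f with h1
  set f2 := f1 - X 1 * divX 1 f1 with h2
  have h3 : f2 - X 0 * divX 0 f2 = C (constantCoeff f) := by
    ext d
    rw [coeff_sub_X_mul_divX, h2, coeff_sub_X_mul_divX, h1, coeff_sub_X_mul_divX, coeff_C]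
    have : d = 0 ↔ d 0 = 0 ∧ d 1 = 0 ∧ d 2 = 0 := by
      constructor
      · rintro rfl; simp
      · rintro ⟨h0, h1, h2⟩
        ext s; fin_cases s <;> simpa
    by_cases hd : d = 0
    · subst hd; simp
    · rw [if_neg hd]
      rw [this] at hd
      split_ifs <;> tauto
  refine ⟨![divX 0 f2, divX 1 f1, divX 2 f], ?_, fun n hn s => ?_⟩
  · simp only [Matrix.cons_val_zero, Matrix.cons_val_one, Matrix.cons_val]
    linear_combination h1 + h2 + h3
  · have h1' := le_order_sub_X_mul_divX 2 hn
    have h2' := le_order_sub_X_mul_divX 1 h1'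
    fin_cases s
    · exact le_order_divX 0 h2'
    · exact le_order_divX 1 h1'
    · exact le_order_divX 2 hn

lemma X_mem_M (s : Fin 3) : (X s : PS K) ∈ M K :=
  Ideal.subset_span (by fin_cases s <;> simp)

lemma mem_M_iff {f : PS K} : f ∈ M K ↔ constantCoeff f = 0 := by
  have hM : M K ≤ RingHom.ker (constantCoeff (σ := Fin 3) (R := K)) := by
    rw [M, Ideal.span_le]
    rintro x (rfl | rfl | rfl) <;> simp [RingHom.mem_ker]
  refine ⟨fun hf => hM hf, fun hf => ?_⟩
  obtain ⟨g, hg, -⟩ := exists_eq_sum_X_mul f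
  rw [hg, hf, map_zero, add_zero]
  exact add_mem (add_mem (Ideal.mul_mem_right _ _ (X_mem_M 0))
    (Ideal.mul_mem_right _ _ (X_mem_M 1))) (Ideal.mul_mem_right _ _ (X_mem_M 2))

lemma notMem_M_iff {f : PS K} : f ∉ M K ↔ IsUnit f := by
  rw [mem_M_iff, isUnit_iff_constantCoeff, isUnit_iff_ne_zero]

lemma M_eq_maximalIdeal : M K = IsLocalRing.maximalIdeal (PS K) := by
  ext f
  rw [IsLocalRing.mem_maximalIdeal, mem_nonunits_iff, ← notMem_M_iff, not_not]

instance : (M K).IsMaximal := by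
  rw [M_eq_maximalIdeal]; infer_instance

lemma le_M {P : Ideal (PS K)} (hP : P ≠ ⊤) : P ≤ M K := by
  rw [M_eq_maximalIdeal]; exact IsLocalRing.le_maximalIdeal hP

lemma le_order_of_mem_M_pow {n : ℕ} {f : PS K} (hf : f ∈ M K ^ n) : (n : ℕ∞) ≤ f.order := by
  induction n generalizing f with
  | zero => simp
  | succ n ih =>
    rw [pow_succ] at hf
    refine Submodule.mul_induction_on hf (fun a ha b hb => ?_) fun a b ha hb => ?_
    · refine le_trans ?_ le_order_mul
      push_cast
      gcongr
      · exact ih ha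
      · exact one_le_order_iff_constCoeff_eq_zero.mpr (mem_M_iff.mp hb)
    · exact (le_min ha hb).trans min_order_le_add

lemma mem_M_pow_iff {n : ℕ} {f : PS K} : f ∈ M K ^ n ↔ (n : ℕ∞) ≤ f.order := by
  refine ⟨le_order_of_mem_M_pow, fun hf => ?_⟩
  induction n generalizing f with
  | zero => simp
  | succ n ih =>
    obtain ⟨g, hg, hord⟩ := exists_eq_sum_X_mul f
    have h0 : constantCoeff f = 0 := by
      rw [← one_le_order_iff_constCoeff_eq_zero]
      refine le_trans ?_ hf
      norm_cast
      omega
    rw [hg, h0, map_zero, add_zero, pow_succ']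
    exact add_mem (add_mem (Ideal.mul_mem_mul (X_mem_M 0) (ih (hord n hf 0)))
      (Ideal.mul_mem_mul (X_mem_M 1) (ih (hord n hf 1))))
      (Ideal.mul_mem_mul (X_mem_M 2) (ih (hord n hf 2)))

end MaximalIdeal

/-! ### Symbolic powers and derivations: the criterion for equimultiplicity. -/

section SymbolicPower

variable {R : Type*} [CommRing R] {P : Ideal R} [P.IsPrime]

lemma mem_symbolicPower_iff {n : ℕ} {x : R} :
    x ∈ symbolicPower P n ↔ ∃ s ∉ P, s * x ∈ P ^ n := by
  rw [symbolicPower, Ideal.mem_comap,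
    IsLocalization.algebraMap_mem_map_algebraMap_iff P.primeCompl]
  rfl

lemma mem_symbolicPower_of_mem_pow {n : ℕ} {x : R} (hx : x ∈ P ^ n) : x ∈ symbolicPower P n :=
  mem_symbolicPower_iff.mpr ⟨1, (Ideal.ne_top_iff_one P).mp (Ideal.IsPrime.ne_top ‹_›), by simpa⟩

lemma symbolicPower_zero : symbolicPower P 0 = ⊤ := by
  rw [eq_top_iff]
  intro x _
  exact mem_symbolicPower_of_mem_pow (by simp)

lemma symbolicPower_one : symbolicPower P 1 = P := by
  ext x
  rw [mem_symbolicPower_iff]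
  constructor
  · rintro ⟨s, hs, h⟩
    rw [pow_one] at h
    exact (Ideal.IsPrime.mem_or_mem ‹_› h).resolve_left hs
  · intro h
    exact ⟨1, (Ideal.ne_top_iff_one P).mp (Ideal.IsPrime.ne_top ‹_›), by simpa⟩

lemma symbolicPower_antitone {m n : ℕ} (h : m ≤ n) : symbolicPower P n ≤ symbolicPower P m := by
  intro x hx
  rw [mem_symbolicPower_iff] at hx ⊢
  obtain ⟨s, hs, hx⟩ := hx
  exact ⟨s, hs, Ideal.pow_le_pow_right h hx⟩

lemma mul_mem_symbolicPower_add {m n : ℕ} {x y : R} (hx : x ∈ symbolicPower P m)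
    (hy : y ∈ symbolicPower P n) : x * y ∈ symbolicPower P (m + n) := by
  rw [mem_symbolicPower_iff] at hx hy ⊢
  obtain ⟨s, hs, hx⟩ := hx
  obtain ⟨t, ht, hy⟩ := hy
  refine ⟨s * t, fun h => ((Ideal.IsPrime.mem_or_mem ‹_› h).elim hs ht), ?_⟩
  rw [pow_add, mul_mul_mul_comm]
  exact Ideal.mul_mem_mul hx hy

lemma mem_symbolicPower_of_mul_mem {n : ℕ} {s x : R} (hs : s ∉ P)
    (h : s * x ∈ symbolicPower P n) : x ∈ symbolicPower P n := by
  rw [mem_symbolicPower_iff] at h ⊢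
  obtain ⟨t, ht, h⟩ := h
  exact ⟨t * s, fun h => ((Ideal.IsPrime.mem_or_mem ‹_› h).elim ht hs), by rwa [mul_assoc]⟩

variable {k : Type*} [CommRing k] [Algebra k R] (D : Derivation k R R)

omit [P.IsPrime] in
lemma derivation_mem_pow {n : ℕ} {x : R} (hx : x ∈ P ^ (n + 1)) : D x ∈ P ^ n := by
  induction n generalizing x with
  | zero => simp
  | succ n ih =>
    rw [pow_succ] at hx
    refine Submodule.mul_induction_on hx (fun a ha b hb => ?_) fun a b ha hb => ?_
    · rw [D.leibniz, smul_eq_mul, smul_eq_mul]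
      refine add_mem (Ideal.mul_mem_right _ _ ha) ?_
      rw [pow_succ']
      exact Ideal.mul_mem_mul hb (ih ha)
    · rw [map_add]
      exact add_mem ha hb

lemma derivation_mem_symbolicPower {n : ℕ} {x : R} (hx : x ∈ symbolicPower P n) :
    D x ∈ symbolicPower P (n - 1) := by
  cases n with
  | zero => simp [symbolicPower_zero]
  | succ n =>
    rw [Nat.add_sub_cancel]
    rw [mem_symbolicPower_iff] at hx ⊢
    obtain ⟨s, hs, hx⟩ := hx
    -- From `s * x ∈ P ^ (n + 1)`, Leibniz gives `s * D x + x * D s ∈ P ^ n`; the second factor `s`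
    -- turns the unwanted term into a multiple of `s * x`.
    refine ⟨s * s, fun h => ((Ideal.IsPrime.mem_or_mem ‹_› h).elim hs hs), ?_⟩
    have h1 := derivation_mem_pow D hx
    rw [D.leibniz, smul_eq_mul, smul_eq_mul] at h1
    have : s * s * D x = s * (s * D x + x * D s) - s * x * D s := by ring
    rw [this]
    exact sub_mem (Ideal.mul_mem_left _ _ h1)
      (Ideal.mul_mem_right _ _ (Ideal.pow_le_pow_right (Nat.le_succ n) hx))

variable {D} {ζ : R}

omit [P.IsPrime] in
lemma derivation_sum_range_succ (hζ : D ζ = 1) {N : ℕ} {e : ℕ → R}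
    (he : ∀ l < N + 1, D (e l) = 0) :
    D (∑ l ∈ Finset.range (N + 1), e l * ζ ^ l) =
      ∑ l ∈ Finset.range N, ((l + 1 : ℕ) * e (l + 1)) * ζ ^ l := by
  rw [Finset.sum_range_succ', map_add, map_sum]
  rw [pow_zero, mul_one, he 0 (by omega), add_zero]
  refine Finset.sum_congr rfl fun l hl => ?_
  rw [Finset.mem_range] at hl
  rw [D.leibniz, D.leibniz_pow, hζ, he (l + 1) (by omega)]
  simp only [smul_eq_mul, nsmul_eq_mul, Nat.add_sub_cancel]
  ring

/-- There is no term in `ζ ^ n`, so `D` applied `n` times leaves a nonzero integer multiple of `ζ`,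
which lies in `P^(1) = P`. The factor `c` collects the integers produced by the induction. -/
lemma mem_of_mem_symbolicPower (hζ : D ζ = 1) (hchar : ∀ n : ℕ, n ≠ 0 → IsUnit (n : R))
    {n : ℕ} {e : ℕ → R} {c : ℕ} (hc : c ≠ 0) (he : ∀ l < n, D (e l) = 0)
    (hF : c * ζ ^ (n + 1) + ∑ l ∈ Finset.range n, e l * ζ ^ l ∈ symbolicPower P (n + 1)) :
    ζ ∈ P := by
  induction n generalizing e c with
  | zero =>
    rw [Finset.sum_range_zero, add_zero, zero_add, pow_one, symbolicPower_one] at hF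
    exact (Ideal.unit_mul_mem_iff_mem P (hchar c hc)).mp hF
  | succ n ih =>
    have h := derivation_mem_symbolicPower D hF
    rw [map_add, derivation_sum_range_succ hζ he] at h
    refine ih (c := c * (n + 2)) (e := fun l => (l + 1 : ℕ) * e (l + 1))
      (by positivity) (fun l hl => ?_) ?_
    · rw [D.leibniz, he (l + 1) (by omega), D.map_natCast]
      simp
    · rw [Nat.add_sub_cancel] at h
      convert h using 2
      rw [D.leibniz, D.map_natCast, D.leibniz_pow, hζ]
      simp only [smul_eq_mul, nsmul_eq_mul, Nat.add_sub_cancel, Nat.cast_mul]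
      push_cast
      ring

/-- The derivative has coefficients `(l + 1) * e (l + 1)`, so induction handles all of them but `e
0`, which is then the sum minus terms already known to lie in `P^(n)`. For `l ≥ n` the exponent `n -
l` is `0` and the claim is empty. -/
lemma coeff_mem_symbolicPower (hζ : D ζ = 1) (hchar : ∀ n : ℕ, n ≠ 0 → IsUnit (n : R))
    (hζP : ζ ∈ P) {N n : ℕ} {e : ℕ → R} (he : ∀ l < N, D (e l) = 0)
    (hF : ∑ l ∈ Finset.range N, e l * ζ ^ l ∈ symbolicPower P n) :
    ∀ l < N, e l ∈ symbolicPower P (n - l) := by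
  induction N generalizing n e with
  | zero => intro l hl; omega
  | succ N ih =>
    have h := derivation_mem_symbolicPower D hF
    rw [derivation_sum_range_succ hζ he] at h
    have h1 : ∀ l < N, e (l + 1) ∈ symbolicPower P (n - (l + 1)) := by
      intro l hl
      have := ih (e := fun l => (l + 1 : ℕ) * e (l + 1)) (fun l hl => by
        rw [D.leibniz, he (l + 1) (by omega), D.map_natCast]
        simp) h l hl
      rw [Nat.sub_sub, add_comm 1] at this
      exact (Ideal.unit_mul_mem_iff_mem _ (hchar (l + 1) (by omega))).mp this
    intro l hl
    cases l with
    | succ l => exact h1 l (by omega)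
    | zero =>
      rw [Finset.sum_range_succ', pow_zero, mul_one] at hF
      refine (Ideal.add_mem_iff_right _ (sum_mem fun l hl => ?_)).mp hF
      refine symbolicPower_antitone (m := n) (n := n - (l + 1) + (l + 1)) (by omega) ?_
      exact mul_mem_symbolicPower_add (h1 l (Finset.mem_range.mp hl))
        (mem_symbolicPower_of_mem_pow (Ideal.pow_mem_pow hζP _))

lemma weierstrass_mem_symbolicPower_iff (hζ : D ζ = 1)
    (hchar : ∀ n : ℕ, n ≠ 0 → IsUnit (n : R)) {n : ℕ} (hn : 1 ≤ n) {e : ℕ → R}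
    (he : ∀ l < n - 1, D (e l) = 0) :
    ζ ^ n + ∑ l ∈ Finset.range (n - 1), e l * ζ ^ l ∈ symbolicPower P n ↔
      ζ ∈ P ∧ ∀ l < n - 1, e l ∈ symbolicPower P (n - l) := by
  constructor
  · intro h
    have hP : ζ ∈ P := by
      refine mem_of_mem_symbolicPower hζ hchar (n := n - 1) (c := 1) one_ne_zero he ?_
      rwa [Nat.cast_one, one_mul, Nat.sub_add_cancel hn]
    refine ⟨hP, coeff_mem_symbolicPower hζ hchar hP he ?_⟩
    exact (Ideal.add_mem_iff_right _
      (mem_symbolicPower_of_mem_pow (Ideal.pow_mem_pow hP n))).mp h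
  · rintro ⟨hP, h⟩
    refine add_mem (mem_symbolicPower_of_mem_pow (Ideal.pow_mem_pow hP n))
      (sum_mem fun l hl => ?_)
    have hl := Finset.mem_range.mp hl
    rw [show n = n - l + l by omega]
    refine mul_mem_symbolicPower_add ?_ (mem_symbolicPower_of_mem_pow (Ideal.pow_mem_pow hP _))
    exact h l hl

end SymbolicPower

lemma mem_symbolicPower_M_iff {n : ℕ} {f : PS K} :
    f ∈ symbolicPower (M K) n ↔ (n : ℕ∞) ≤ f.order := by
  rw [← mem_M_pow_iff, mem_symbolicPower_iff]
  constructor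
  · rintro ⟨s, hs, h⟩
    exact (Ideal.unit_mul_mem_iff_mem _ (notMem_M_iff.mp hs)).mp h
  · intro h
    exact ⟨1, notMem_M_iff.mpr isUnit_one, by simpa⟩

lemma isUnit_natCast [CharZero K] (n : ℕ) (hn : n ≠ 0) : IsUnit (n : PS K) := by
  rw [isUnit_iff_constantCoeff, map_natCast, isUnit_iff_ne_zero]
  exact_mod_cast hn

/-! ### The equimultiple locus in terms of Weierstrass coefficients. -/

section WeierstrassEquation

/-- The coefficients `a` and the equation `F` of a surface in Weierstrass form. -/
def HasWeierstrassCoeffs (n : ℕ) (a : ℕ → PS K) (F : PS K) : Prop :=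
  1 ≤ n ∧ (∀ k < n - 1, InXY (a k) ∧ ((n - k : ℕ) : ℕ∞) ≤ (a k).order) ∧
    F = X 2 ^ n + ∑ k ∈ Finset.range (n - 1), a k * X 2 ^ k

lemma IsWeierstrassEquation.exists_coeffs {n : ℕ} {F : PS K} (h : IsWeierstrassEquation n F) :
    ∃ a, HasWeierstrassCoeffs n a F := by
  obtain ⟨hn, a, ha, hF⟩ := h
  exact ⟨a, hn, fun k hk => ha k (Finset.mem_range.mpr hk), hF⟩

/-- The criterion for `D = ∂/∂Z` and `ζ = Z + c`; transforms first appear in powers of `Z + c`. -/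
lemma weierstrass_translate_mem_symbolicPower_iff [CharZero K] {P : Ideal (PS K)} [P.IsPrime]
    {n : ℕ} (hn : 1 ≤ n) {e : ℕ → PS K} (he : ∀ k < n - 1, InXY (e k)) (c : K) :
    (X 2 + C c) ^ n + ∑ k ∈ Finset.range (n - 1), e k * (X 2 + C c) ^ k ∈ symbolicPower P n ↔
      X 2 + C c ∈ P ∧ ∀ k < n - 1, e k ∈ symbolicPower P (n - k) :=
  weierstrass_mem_symbolicPower_iff (D := pderiv K 2) (by simp) isUnit_natCast hn
    fun k hk => (he k hk).pderiv

lemma weierstrass_mem_symbolicPower_iff' [CharZero K] {P : Ideal (PS K)} [P.IsPrime]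
    {n : ℕ} (hn : 1 ≤ n) {e : ℕ → PS K} (he : ∀ k < n - 1, InXY (e k)) :
    X 2 ^ n + ∑ k ∈ Finset.range (n - 1), e k * X 2 ^ k ∈ symbolicPower P n ↔
      X 2 ∈ P ∧ ∀ k < n - 1, e k ∈ symbolicPower P (n - k) := by
  simpa using weierstrass_translate_mem_symbolicPower_iff (P := P) hn he 0

/-- A monic polynomial in `Z + c`, without second term, whose order is its degree, is a
Weierstrass equation: `c = 0`. -/
lemma hasWeierstrassCoeffs_of_le_order [CharZero K] {n : ℕ} (hn : 1 ≤ n) {e : ℕ → PS K}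
    (he : ∀ k < n - 1, InXY (e k)) {c : K} {F : PS K}
    (hF : F = (X 2 + C c) ^ n + ∑ k ∈ Finset.range (n - 1), e k * (X 2 + C c) ^ k)
    (hord : (n : ℕ∞) ≤ F.order) : c = 0 ∧ HasWeierstrassCoeffs n e F := by
  have h := mem_symbolicPower_M_iff.mpr hord
  rw [hF, weierstrass_translate_mem_symbolicPower_iff hn he] at h
  have hc : c = 0 := by simpa [mem_M_iff] using h.1
  refine ⟨hc, hn, fun k hk => ⟨he k hk, mem_symbolicPower_M_iff.mp (h.2 k hk)⟩, ?_⟩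
  rw [hF, hc, map_zero, add_zero]

variable {n : ℕ} {a : ℕ → PS K} {F : PS K}

/-- The monomial `Z ^ n` cannot cancel, because the `a k` do not involve `Z` and come with `Z ^ k`,
`k < n`. The lower bound is the criterion at `P = M`. -/
lemma HasWeierstrassCoeffs.order_eq [CharZero K] (h : HasWeierstrassCoeffs n a F) :
    F.order = n := by
  classical
  obtain ⟨hn, ha, rfl⟩ := h
  apply le_antisymm
  · refine (order_le (d := Finsupp.single 2 n) ?_).trans (by simp)
    rw [map_add, map_sum, coeff_X_pow, if_pos rfl, Finset.sum_eq_zero, add_zero]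
    · exact one_ne_zero
    intro k hk
    have hk := Finset.mem_range.mp hk
    rw [X_pow_eq, coeff_mul_monomial]
    split_ifs
    · rw [(ha k hk).1, zero_mul]
      rw [Finsupp.tsub_apply, Finsupp.single_eq_same, Finsupp.single_eq_same]
      omega
    · rfl
  · rw [← mem_symbolicPower_M_iff, weierstrass_mem_symbolicPower_iff' hn fun k hk => (ha k hk).1]
    exact ⟨X_mem_M 2, fun k hk => mem_symbolicPower_M_iff.mpr (ha k hk).2⟩

lemma HasWeierstrassCoeffs.mult_eq [CharZero K] (h : HasWeierstrassCoeffs n a F) :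
    mult F = n := by
  rw [mult, h.order_eq, ENat.toNat_natCast]

lemma HasWeierstrassCoeffs.mem_equimultipleLocus_iff [CharZero K]
    (h : HasWeierstrassCoeffs n a F) {P : Ideal (PS K)} :
    P ∈ equimultipleLocus F ↔
      ∃ _ : P.IsPrime, X 2 ∈ P ∧ ∀ k < n - 1, a k ∈ symbolicPower P (n - k) := by
  refine exists_congr fun _ => ?_
  rw [h.mult_eq, h.2.2, weierstrass_mem_symbolicPower_iff' h.1 fun k hk => (h.2.1 k hk).1]

lemma isRegularLocalRing_quotient_M : IsRegularLocalRing (PS K ⧸ M K) := by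
  let := Ideal.Quotient.field (M K)
  infer_instance

lemma HasWeierstrassCoeffs.M_mem_smoothLocus [CharZero K] (h : HasWeierstrassCoeffs n a F) :
    M K ∈ smoothLocus F :=
  ⟨h.mem_equimultipleLocus_iff.mpr ⟨inferInstance, X_mem_M 2,
    fun k hk => mem_symbolicPower_M_iff.mpr (h.2.1 k hk).2⟩, isRegularLocalRing_quotient_M⟩

end WeierstrassEquation

/-! ### Primes of the form `(Z, G)`. -/

section SpanPair

variable {i j : Fin 3} (h : IsXYPair i j)

lemma isPrime_span_pair_iff {G : PS K} (hG : InXY G) (hG0 : G ≠ 0) :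
    (Ideal.span {X 2, G}).IsPrime ↔ Prime (restrict h G) := by
  have h0 : restrict h G ≠ 0 := fun e =>
    hG0 (hG.restrict_injective h (xySubring K).zero_mem (by rw [e, map_zero]))
  rw [← Ideal.span_singleton_prime h0]
  have : Ideal.span {X 2, G} = Ideal.comap (restrict h) (Ideal.span {restrict h G}) := by
    ext f
    rw [mem_span_pair_iff h f hG, Ideal.mem_comap, Ideal.mem_span_singleton]
  rw [this]
  refine ⟨fun hp => ?_, fun hp => hp.comap _⟩
  have hs : Function.Surjective (restrict (K := K) h) := fun g => ⟨_, restrict_extend h g⟩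
  rw [← Ideal.map_comap_of_surjective _ hs (Ideal.span {restrict h G})]
  exact Ideal.map_isPrime_of_surjective hs (Ideal.comap_mono bot_le)

/-- Setting `Z = 0` sends `(Z, G) ^ m` to `(G ^ m)`, and the multiplier outside the ideal cancels
because `G` is prime in `K[[X,Y]]` and does not divide it. -/
lemma mem_symbolicPower_span_pair_iff {G : PS K} (hG : InXY G) (hG0 : G ≠ 0)
    [hP : (Ideal.span {X 2, G}).IsPrime] {f : PS K} (hf : InXY f) {m : ℕ} :
    f ∈ symbolicPower (Ideal.span {X 2, G}) m ↔ G ^ m ∣ f := by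
  constructor
  · intro hfm
    obtain ⟨s, hs, hsf⟩ := mem_symbolicPower_iff.mp hfm
    have hprime := (isPrime_span_pair_iff isXYPair_zero_one hG hG0).mp hP
    rw [mem_span_pair_iff isXYPair_zero_one s hG] at hs
    have h1 : restrict isXYPair_zero_one G ^ m ∣ restrict isXYPair_zero_one (s * f) := by
      have h2 := Ideal.mem_map_of_mem (restrict isXYPair_zero_one) hsf
      rw [Ideal.map_pow, Ideal.map_span, Set.image_pair, restrict_X_two] at h2
      rwa [Ideal.span_insert_zero, Ideal.span_singleton_pow, Ideal.mem_span_singleton] at h2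
    rw [map_mul] at h1
    rw [← (hG.pow m).dvd_iff isXYPair_zero_one hf, map_pow]
    exact hprime.pow_dvd_of_dvd_mul_left m hs h1
  · rintro ⟨q, rfl⟩
    exact mem_symbolicPower_of_mem_pow (Ideal.mul_mem_right _ _
      (Ideal.pow_mem_pow (Ideal.subset_span (by simp)) m))

end SpanPair

/-! ### Krull dimension of quotients contained in the plane `Z = 0`. -/

section Dimension

lemma ringKrullDim_powerSeries_field : ringKrullDim (PowerSeries K) = 1 :=
  IsDiscreteValuationRing.ringKrullDim_eq_one _

lemma ringKrullDim_powerSeries_powerSeries :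
    ringKrullDim (PowerSeries (PowerSeries K)) = 2 := by
  apply le_antisymm
  · have h1 := ringKrullDim_le_ringKrullDim_quotient_add_card
      ({PowerSeries.X} : Finset (PowerSeries (PowerSeries K))) (by
        rw [Finset.coe_singleton, Set.singleton_subset_iff, SetLike.mem_coe,
          IsLocalRing.ringJacobson_eq_maximalIdeal, IsLocalRing.mem_maximalIdeal,
          mem_nonunits_iff, PowerSeries.isUnit_iff_constantCoeff]
        simp)
    refine h1.trans ?_
    have h2 : Function.Surjective ((Ideal.Quotient.mk (Ideal.span
        ((({PowerSeries.X} : Finset (PowerSeries (PowerSeries K)))) :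
          Set (PowerSeries (PowerSeries K))))).comp PowerSeries.C) := by
      intro x
      obtain ⟨f, rfl⟩ := Ideal.Quotient.mk_surjective x
      refine ⟨PowerSeries.constantCoeff f, ?_⟩
      rw [RingHom.comp_apply, Ideal.Quotient.eq, Finset.coe_singleton, Ideal.mem_span_singleton,
        PowerSeries.X_dvd_iff]
      simp
    have h3 := ringKrullDim_le_of_surjective _ h2
    rw [ringKrullDim_powerSeries_field] at h3
    rw [Finset.card_singleton]
    calc _ ≤ (1 : WithBot ℕ∞) + (1 : ℕ) := by gcongr
      _ = 2 := by norm_num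
  · have := ringKrullDim_succ_le_ringKrullDim_powerseries (R := PowerSeries K)
    rw [ringKrullDim_powerSeries_field] at this
    refine le_trans (by norm_num) this

/-- It ensures that `(Z)` is not a curve, so that a curve `(Z, G)` has `G ≠ 0`. -/
lemma two_le_ringKrullDim_quotient_span_X_two :
    2 ≤ ringKrullDim (PS K ⧸ Ideal.span {(X 2 : PS K)}) := by
  rw [← ringKrullDim_powerSeries_powerSeries (K := K)]
  refine ringKrullDim_le_of_surjective
    (Ideal.Quotient.lift _ (restrict isXYPair_zero_one) fun f hf => ?_)
    (Ideal.Quotient.lift_surjective_of_surjective _ _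
      fun g => ⟨_, restrict_extend isXYPair_zero_one g⟩)
  obtain ⟨q, rfl⟩ := Ideal.mem_span_singleton.mp hf
  simp

lemma extend_quotient_surjective {i j : Fin 3} (h : IsXYPair i j) {P : Ideal (PS K)}
    (hZ : X 2 ∈ P) : Function.Surjective ((Ideal.Quotient.mk P).comp (extend h)) := by
  intro x
  obtain ⟨f, rfl⟩ := Ideal.Quotient.mk_surjective x
  refine ⟨restrict h f, ?_⟩
  rw [RingHom.comp_apply, eq_comm, Ideal.Quotient.eq]
  exact Ideal.mem_of_dvd _ (X_two_dvd_sub h f) hZ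

/-- The quotient is an image of the two-dimensional domain `K[[X]][[Y]]` in which a nonzero element
dies, so the dimension drops. -/
lemma ringKrullDim_quotient_le_one {P : Ideal (PS K)} (hZ : X 2 ∈ P) {g : PS K}
    (hg : InXY g) (hg0 : g ≠ 0) (hgP : g ∈ P) : ringKrullDim (PS K ⧸ P) ≤ 1 := by
  have h := isXYPair_zero_one
  have h0 : restrict h g ≠ 0 := fun e =>
    hg0 (hg.restrict_injective h (xySubring K).zero_mem (by rw [e, map_zero]))
  have h1 := ringKrullDim_succ_le_of_surjective _ (extend_quotient_surjective h hZ)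
    (mem_nonZeroDivisors_of_ne_zero h0)
    (by rw [RingHom.comp_apply, hg.extend_restrict, Ideal.Quotient.eq_zero_iff_mem]; exact hgP)
  rw [ringKrullDim_powerSeries_powerSeries] at h1
  generalize ringKrullDim (PS K ⧸ P) = d at h1 ⊢
  induction d with
  | bot => exact bot_le
  | coe d =>
    induction d using ENat.recTopCoe with
    | top => exact absurd h1 (by decide)
    | coe d =>
      have h1' : (d : ℕ∞) + 1 ≤ 2 := WithBot.coe_le_coe.mp h1
      have h2 : ((d + 1 : ℕ) : ℕ∞) ≤ ((2 : ℕ) : ℕ∞) := by exact_mod_cast h1'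
      have h3 : d ≤ 1 := by
        rw [Nat.cast_le] at h2
        omega
      exact_mod_cast h3

/-- A prime ideal containing a curve is the curve or the closed point. -/
lemma IsCurve.eq_or_eq_M {P P' : Ideal (PS K)} [P.IsPrime] (hP : IsCurve P) (hP' : P'.IsPrime)
    (hle : P ≤ P') : P' = P ∨ P' = M K := by
  have hdim : Ring.KrullDimLE 1 (PS K ⧸ P) := Ring.krullDimLE_iff.mpr hP.le
  have hprime := Ideal.isPrime_map_quotientMk_of_isPrime hle
  by_cases h0 : P'.map (Ideal.Quotient.mk P) = ⊥
  · left
    rw [Ideal.map_eq_bot_iff_le_ker, Ideal.mk_ker] at h0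
    exact le_antisymm h0 hle
  · right
    have hmax := (Ring.krullDimLE_one_iff_of_isPrime_bot.mp hdim _ h0 hprime)
    have := Ideal.comap_isMaximal_of_surjective _ Ideal.Quotient.mk_surjective (K := P'.map _)
      (H := hmax)
    rw [Ideal.comap_map_of_surjective _ Ideal.Quotient.mk_surjective, ← RingHom.ker_eq_comap_bot,
      Ideal.mk_ker, sup_eq_left.mpr hle] at this
    rw [M_eq_maximalIdeal]
    exact IsLocalRing.eq_maximalIdeal this

end Dimension

/-! ### Substitution in Weierstrass equations, and monoidal transforms. -/

section Substitution

lemma subst_congr {a b : Fin 3 → PS K} (ha : HasSubst a) (hb : HasSubst b) {f : PS K}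
    (h : ∀ d, coeff d f ≠ 0 → ∀ s, d s ≠ 0 → a s = b s) : subst a f = subst b f := by
  ext e
  rw [coeff_subst ha, coeff_subst hb]
  refine finsum_congr fun d => ?_
  by_cases hd : coeff d f = 0
  · rw [hd, zero_smul, zero_smul]
  · congr 2
    refine Finsupp.prod_congr fun s hs => ?_
    rw [h d hd s (Finsupp.mem_support_iff.mp hs)]

lemma InXY.subst_eq_self {a : Fin 3 → PS K} (ha : HasSubst a) (h : ∀ s ≠ 2, a s = X s)
    {f : PS K} (hf : InXY f) : subst a f = f := by
  rw [subst_congr ha HasSubst.X fun d hd s hs => ?_, subst_self, id]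
  refine h s ?_
  rintro rfl
  exact hd (hf d hs)

lemma subst_weierstrass {a : Fin 3 → PS K} (ha : HasSubst a) (n : ℕ) (e : ℕ → PS K) :
    subst a (X 2 ^ n + ∑ k ∈ Finset.range (n - 1), e k * X 2 ^ k) =
      a 2 ^ n + ∑ k ∈ Finset.range (n - 1), subst a (e k) * a 2 ^ k := by
  simp only [← coe_substAlgHom ha, map_add, map_pow, map_sum, map_mul]
  rw [coe_substAlgHom, subst_X ha]

/-- If the `k`-th coefficients of a Weierstrass equation are divisible by `g ^ (n - k)`, then
so is the equation after replacing `Z` by `g * ζ`. -/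
lemma mul_pow_weierstrass (n : ℕ) (g ζ : PS K) (b : ℕ → PS K) :
    (g * ζ) ^ n + ∑ k ∈ Finset.range (n - 1), g ^ (n - k) * b k * (g * ζ) ^ k =
      g ^ n * (ζ ^ n + ∑ k ∈ Finset.range (n - 1), b k * ζ ^ k) := by
  rw [mul_add, mul_pow, Finset.mul_sum]
  congr 1
  refine Finset.sum_congr rfl fun k hk => ?_
  have hk := Finset.mem_range.mp hk
  rw [show g ^ n = g ^ (n - k) * g ^ k by rw [← pow_add]; congr 1; omega]
  ring

end Substitution

/-- Writing `a k = G ^ (n - k) * e k`, the transform has coefficients `e k`. At a prime not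
containing `G` the conditions on `a k` and on `e k` agree. -/
theorem smoothLocus_of_isMonoidalTransform [CharZero K] {n : ℕ} {a : ℕ → PS K} {F F₁ : PS K}
    (h : HasWeierstrassCoeffs n a F) {P : Ideal (PS K)} (hP : P ∈ smoothLocus F)
    (hcurve : IsCurve P) (hF₁ : IsMonoidalTransform P F F₁) (hord : F₁.order = F.order) :
    smoothLocus F₁ = smoothLocus F ∨ smoothLocus F₁ = smoothLocus F \ {P} := by
  obtain ⟨G, c, hG, hPG, hsubst⟩ := hF₁
  obtain ⟨hPp, hZ, haP⟩ := h.mem_equimultipleLocus_iff.mp hP.1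
  have hG0 : G ≠ 0 := by
    rintro rfl
    have h2 := two_le_ringKrullDim_quotient_span_X_two (K := K)
    rw [Set.pair_comm, Ideal.span_insert_zero] at hPG
    rw [← hPG, hcurve] at h2
    exact absurd h2 (by decide)
  have hGP : G ∈ P := hPG ▸ Ideal.subset_span (by simp)
  -- The value `0` outside the range of indices makes the quotients a function on all of `ℕ`.
  have hdvd : ∀ k, ∃ e, InXY e ∧ (k < n - 1 → a k = G ^ (n - k) * e) := by
    intro k
    by_cases hk : k < n - 1
    · have h1 := haP k hk
      subst hPG
      rw [mem_symbolicPower_span_pair_iff hG hG0 (h.2.1 k hk).1] at h1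
      obtain ⟨e, he, hae⟩ := (hG.pow _).exists_eq_mul_of_dvd (h.2.1 k hk).1 h1
      exact ⟨e, he, fun _ => hae⟩
    · exact ⟨0, (xySubring K).zero_mem, fun h => absurd h hk⟩
  choose e he hae using hdvd
  have hsub := hasSubst_monoidalSubst G (mem_M_iff.mp (le_M hPp.ne_top hGP)) c
  have hF : F₁ = (X 2 + C c) ^ n + ∑ k ∈ Finset.range (n - 1), e k * (X 2 + C c) ^ k := by
    rw [h.mult_eq, h.2.2, subst_weierstrass hsub] at hsubst
    refine mul_left_cancel₀ (pow_ne_zero n hG0) ?_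
    rw [← mul_pow_weierstrass, ← hsubst]
    congr 1
    refine Finset.sum_congr rfl fun k hk => ?_
    have hk := Finset.mem_range.mp hk
    rw [(h.2.1 k hk).1.subst_eq_self hsub, ← hae k hk]
    · rfl
    · intro s hs
      fin_cases s
      · rfl
      · rfl
      · exact absurd rfl hs
  obtain ⟨-, h₁⟩ := hasWeierstrassCoeffs_of_le_order h.1 (fun k _ => he k) hF
    (by rw [hord, h.order_eq])
  have key : ∀ P' ≠ P, P' ∈ smoothLocus F₁ ↔ P' ∈ smoothLocus F := by
    intro P' hne
    by_cases hM : P' = M K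
    · subst hM
      exact iff_of_true h₁.M_mem_smoothLocus h.M_mem_smoothLocus
    refine and_congr_left fun _ => ?_
    rw [h₁.mem_equimultipleLocus_iff, h.mem_equimultipleLocus_iff]
    refine exists_congr fun hP' => and_congr_right fun hZ' => forall₂_congr fun k hk => ?_
    -- Otherwise `P ≤ P'`, and only `P` and `M` lie above a curve.
    have hGP' : G ∉ P' := by
      intro hGP'
      have hle : P ≤ P' := by
        rw [hPG, Ideal.span_le]
        rintro x (rfl | rfl) <;> assumption
      exact (hcurve.eq_or_eq_M hP' hle).elim hne hM
    rw [hae k hk]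
    exact ⟨fun h => Ideal.mul_mem_left _ _ h, fun h =>
      mem_symbolicPower_of_mul_mem (fun h' => hGP' (hP'.mem_of_pow_mem _ h')) h⟩
  by_cases hP₁ : P ∈ smoothLocus F₁
  · left
    ext P'
    by_cases hne : P' = P
    · subst hne
      exact iff_of_true hP₁ hP
    · exact key P' hne
  · right
    ext P'
    by_cases hne : P' = P
    · subst hne
      exact iff_of_false hP₁ (by simp)
    · rw [key P' hne]
      simp [hne]

/-! ### Weierstrass division and preparation over `K[[X]]`. -/

section Weierstrass

instance : IsAdicComplete (IsLocalRing.maximalIdeal (PowerSeries K)) (PowerSeries K) := by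
  rw [PowerSeries.maximalIdeal_eq_span_X]
  infer_instance

/-- The series `g`, with coefficients in `K[[X]]`, is regular of order `m` in its variable. -/
def IsRegularOfOrder (m : ℕ) (g : PowerSeries (PowerSeries K)) : Prop :=
  IsUnit (PowerSeries.coeff m g) ∧ ∀ l < m, ¬ IsUnit (PowerSeries.coeff l g)

variable {m : ℕ} {g : PowerSeries (PowerSeries K)}

lemma IsRegularOfOrder.order_map_residue (hg : IsRegularOfOrder m g) :
    (g.map (IsLocalRing.residue (PowerSeries K))).order = m := by
  rw [PowerSeries.order_eq_nat]
  refine ⟨?_, fun l hl => ?_⟩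
  · rw [PowerSeries.coeff_map, ne_eq, IsLocalRing.residue_eq_zero_iff]
    simpa using hg.1
  · rw [PowerSeries.coeff_map, IsLocalRing.residue_eq_zero_iff]
    simpa using hg.2 l hl

lemma IsRegularOfOrder.map_residue_ne_zero (hg : IsRegularOfOrder m g) :
    g.map (IsLocalRing.residue (PowerSeries K)) ≠ 0 := by
  intro h
  have := hg.order_map_residue
  rw [h, PowerSeries.order_zero] at this
  exact absurd this (ENat.top_ne_natCast m)

lemma IsRegularOfOrder.exists_div (hg : IsRegularOfOrder m g) (f : PowerSeries (PowerSeries K)) :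
    ∃ (q : PowerSeries (PowerSeries K)) (r : Polynomial (PowerSeries K)),
      r.degree < m ∧ f = g * q + r := by
  obtain ⟨q, r, h⟩ := PowerSeries.exists_isWeierstrassDivision f hg.map_residue_ne_zero
  refine ⟨q, r, ?_, h.eq_mul_add⟩
  have := h.degree_lt
  change r.degree < (g.map (IsLocalRing.residue (PowerSeries K))).order.toNat at this
  rwa [hg.order_map_residue, ENat.toNat_natCast] at this

/-- Uniqueness of division, applied to `0 = g * (-q) + r`. -/
lemma IsRegularOfOrder.eq_zero_of_dvd (hg : IsRegularOfOrder m g)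
    {r : Polynomial (PowerSeries K)} (hr : r.degree < m)
    (h : g ∣ (r : PowerSeries (PowerSeries K))) : r = 0 := by
  obtain ⟨q, hq⟩ := h
  refine (PowerSeries.IsWeierstrassDivision.eq_zero (q := -q) hg.map_residue_ne_zero
    ⟨?_, by rw [hq]; ring⟩).2
  change r.degree < (g.map (IsLocalRing.residue (PowerSeries K))).order.toNat
  rwa [hg.order_map_residue, ENat.toNat_natCast]

lemma IsRegularOfOrder.exists_distinguished (hg : IsRegularOfOrder m g) :
    ∃ f : Polynomial (PowerSeries K), f.Monic ∧ f.natDegree = m ∧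
      (∀ l < m, PowerSeries.X ∣ f.coeff l) ∧
      Associated (f : PowerSeries (PowerSeries K)) g := by
  obtain ⟨f, u, h⟩ := PowerSeries.exists_isWeierstrassFactorization hg.map_residue_ne_zero
  have hdeg : f.natDegree = m := by
    rw [h.natDegree_eq_toNat_order_map, hg.order_map_residue, ENat.toNat_natCast]
  refine ⟨f, h.isDistinguishedAt.monic, hdeg, fun l hl => ?_, ?_⟩
  · rw [← Ideal.mem_span_singleton, ← PowerSeries.maximalIdeal_eq_span_X]
    exact h.isDistinguishedAt.mem (by rwa [hdeg])
  · rw [h.eq_mul]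
    exact associated_mul_unit_right _ _ h.isUnit

lemma exists_isRegularOfOrder (hg : ¬ PowerSeries.C PowerSeries.X ∣ g) :
    ∃ m, IsRegularOfOrder m g := by
  classical
  have h : ∃ m, IsUnit (PowerSeries.coeff m g) := by
    by_contra! hne
    apply hg
    have h1 : ∀ m, ∃ q, PowerSeries.coeff m g = PowerSeries.X * q := by
      intro m
      have := hne m
      rwa [← mem_nonunits_iff, ← IsLocalRing.mem_maximalIdeal,
        PowerSeries.maximalIdeal_eq_span_X, Ideal.mem_span_singleton] at this
    choose q hq using h1
    refine ⟨PowerSeries.mk q, ?_⟩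
    ext1 m
    rw [PowerSeries.coeff_C_mul, PowerSeries.coeff_mk, hq]
  exact ⟨Nat.find h, Nat.find_spec h, fun l hl => Nat.find_min h hl⟩

end Weierstrass

/-! ### Smooth curves in the plane `Z = 0`. -/

section SmoothCurve

variable {i j : Fin 3}

lemma IsXYPair.symm (h : IsXYPair i j) : IsXYPair j i := ⟨h.1.symm, h.2.2, h.2.1⟩

lemma isUnit_coeff_restrict_iff (h : IsXYPair i j) (f : PS K) (l : ℕ) :
    IsUnit (PowerSeries.coeff l (restrict h f)) ↔ coeff (xyExp i j 0 l) f ≠ 0 := by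
  rw [PowerSeries.isUnit_iff_constantCoeff, ← PowerSeries.coeff_zero_eq_constantCoeff_apply,
    coeff_coeff_restrict, isUnit_iff_ne_zero]

lemma isRegularOfOrder_restrict_iff (h : IsXYPair i j) (f : PS K) (m : ℕ) :
    IsRegularOfOrder m (restrict h f) ↔
      coeff (xyExp i j 0 m) f ≠ 0 ∧ ∀ l < m, coeff (xyExp i j 0 l) f = 0 := by
  simp only [IsRegularOfOrder, isUnit_coeff_restrict_iff, not_not]

lemma xyExp_zero_one : xyExp i j 0 1 = Finsupp.single j 1 := by simp [xyExp]

lemma xyExp_zero_zero : xyExp i j 0 0 = 0 := by simp [xyExp]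

lemma isRegularOfOrder_one_restrict (h : IsXYPair i j) {G : PS K} (hG0 : constantCoeff G = 0)
    (hGj : coeff (Finsupp.single j 1) G ≠ 0) : IsRegularOfOrder 1 (restrict h G) := by
  rw [isRegularOfOrder_restrict_iff, xyExp_zero_one]
  refine ⟨hGj, fun l hl => ?_⟩
  obtain rfl : l = 0 := by omega
  rwa [xyExp_zero_zero, coeff_zero_eq_constantCoeff_apply]

/-- A smooth plane curve is isomorphic to `Spec K[[X]]`. -/
lemma exists_quotient_ringEquiv (h : IsXYPair i j) {G : PS K} (hG : InXY G)
    (hG0 : constantCoeff G = 0) (hGj : coeff (Finsupp.single j 1) G ≠ 0) :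
    Nonempty (PowerSeries K ≃+* PS K ⧸ Ideal.span {X 2, G}) := by
  have hreg := isRegularOfOrder_one_restrict h hG0 hGj
  -- Remainders modulo a series of order one in `X j` are constants in `K[[X i]]`: existence of the
  -- division gives surjectivity, uniqueness gives injectivity.
  have hdeg : ∀ r : Polynomial (PowerSeries K), r.degree < (1 : ℕ) →
      ∃ c, r = Polynomial.C c := fun r hr =>
    ⟨_, Polynomial.eq_C_of_degree_le_zero (Nat.WithBot.lt_one_iff_le_zero.mp hr)⟩
  refine ⟨RingEquiv.ofBijective (((Ideal.Quotient.mk (Ideal.span {X 2, G})).comp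
    (extend h)).comp PowerSeries.C) ⟨?_, ?_⟩⟩
  · rw [injective_iff_map_eq_zero]
    intro c hc
    rw [RingHom.comp_apply, RingHom.comp_apply, Ideal.Quotient.eq_zero_iff_mem,
      mem_span_pair_iff h _ hG, restrict_extend, ← Polynomial.coe_C] at hc
    have := hreg.eq_zero_of_dvd (lt_of_le_of_lt Polynomial.degree_C_le (by norm_num)) hc
    simpa using this
  · intro x
    obtain ⟨f, rfl⟩ := Ideal.Quotient.mk_surjective x
    obtain ⟨q, r, hr, hf⟩ := hreg.exists_div (restrict h f)
    obtain ⟨c, rfl⟩ := hdeg r hr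
    refine ⟨c, ?_⟩
    rw [RingHom.comp_apply, RingHom.comp_apply, eq_comm, Ideal.Quotient.eq,
      mem_span_pair_iff h _ hG, map_sub, restrict_extend, hf, Polynomial.coe_C]
    exact ⟨q, by ring⟩

lemma smooth_span_pair_aux (h : IsXYPair i j) {G : PS K} (hG : InXY G)
    (hG0 : constantCoeff G = 0) (hGj : coeff (Finsupp.single j 1) G ≠ 0) :
    (Ideal.span {X 2, G}).IsPrime ∧ IsRegularLocalRing (PS K ⧸ Ideal.span {X 2, G}) ∧
      IsCurve (Ideal.span {X 2, G}) := by
  obtain ⟨e⟩ := exists_quotient_ringEquiv h hG hG0 hGj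
  refine ⟨?_, IsRegularLocalRing.of_ringEquiv e, ?_⟩
  · rw [← Ideal.Quotient.isDomain_iff_prime]
    exact MulEquiv.isDomain (PowerSeries K) e.symm.toMulEquiv
  · rw [IsCurve, ← ringKrullDim_eq_of_ringEquiv e, ringKrullDim_powerSeries_field]

/-- The linear part of the series, restricted to `Z = 0`, is not zero. -/
def HasLinearPart (G : PS K) : Prop :=
  coeff (Finsupp.single 0 1) G ≠ 0 ∨ coeff (Finsupp.single 1 1) G ≠ 0

lemma hasLinearPart_iff (h : IsXYPair i j) {G : PS K} : HasLinearPart G ↔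
    coeff (Finsupp.single i 1) G ≠ 0 ∨ coeff (Finsupp.single j 1) G ≠ 0 := by
  obtain ⟨h1, h2, h3⟩ := h
  rw [HasLinearPart]
  fin_cases i <;> fin_cases j <;> simp_all
  all_goals exact or_comm

lemma smooth_span_pair {G : PS K} (hG : InXY G) (hG0 : constantCoeff G = 0)
    (hGl : HasLinearPart G) :
    (Ideal.span {X 2, G}).IsPrime ∧ IsRegularLocalRing (PS K ⧸ Ideal.span {X 2, G}) ∧
      IsCurve (Ideal.span {X 2, G}) := by
  rcases hGl with h | h
  · exact smooth_span_pair_aux isXYPair_zero_one.symm hG hG0 h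
  · exact smooth_span_pair_aux isXYPair_zero_one hG hG0 h

lemma not_isCurve_M : ¬ IsCurve (M K) := by
  let := Ideal.Quotient.field (M K)
  rw [IsCurve, ringKrullDim_eq_zero_of_field]
  decide

lemma coeff_single_one_mul (s : Fin 3) (f g : PS K) :
    coeff (Finsupp.single s 1) (f * g) =
      constantCoeff f * coeff (Finsupp.single s 1) g +
        coeff (Finsupp.single s 1) f * constantCoeff g := by
  have h : ∀ f : PS K, coeff (Finsupp.single s 1) f = constantCoeff (pderiv K s f) := by
    intro f
    rw [← coeff_zero_eq_constantCoeff_apply, coeff_pderiv]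
    simp
  rw [h, Derivation.leibniz, h, h]
  simp
  ring

lemma coeff_single_one_X (s t : Fin 3) :
    coeff (Finsupp.single s 1) (X t : PS K) = if s = t then 1 else 0 := by
  classical
  rw [coeff_X]
  simp only [Finsupp.single_left_inj (one_ne_zero : (1 : ℕ) ≠ 0)]

lemma order_eq_one_of_hasLinearPart {G : PS K} (hG0 : constantCoeff G = 0)
    (hGl : HasLinearPart G) : G.order = 1 := by
  apply le_antisymm
  · rcases hGl with h | h <;> simpa using order_le h
  · rwa [one_le_order_iff_constCoeff_eq_zero]

lemma hasLinearPart_of_order_eq_one {G : PS K} (hG : InXY G) (h : G.order = 1) :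
    HasLinearPart G := by
  obtain ⟨d, hd, hdeg⟩ := exists_coeff_ne_zero_and_order (f := G) (by rw [h]; rfl)
  rw [h] at hdeg
  have hdeg : d.degree = 1 := by exact_mod_cast hdeg
  have h2 : d 2 = 0 := by
    by_contra h2
    exact hd (hG d h2)
  have hp := isXYPair_zero_one
  rw [hp.degree, h2] at hdeg
  rw [hp.eq_xyExp h2] at hd
  rw [HasLinearPart]
  rcases Nat.eq_zero_or_pos (d 0) with h0 | h0
  · right
    rwa [h0, show d 1 = 1 by omega, xyExp_zero_one] at hd
  · left
    rw [show d 0 = 1 by omega, show d 1 = 0 by omega] at hd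
    simpa [xyExp] using hd

/-- A prime defining a regular scheme of dimension at most one, contained in the plane `Z = 0`,
contains a series with nonzero linear part. -/
lemma exists_mem_hasLinearPart {P : Ideal (PS K)} (hP : P.IsPrime)
    (hreg : IsRegularLocalRing (PS K ⧸ P)) (hdim : ringKrullDim (PS K ⧸ P) ≤ 1)
    (hZ : X 2 ∈ P) : ∃ H ∈ P, InXY H ∧ HasLinearPart H := by
  have hle := le_M hP.ne_top
  have hunit : ∀ f : PS K, Ideal.Quotient.mk P f ∈ IsLocalRing.maximalIdeal (PS K ⧸ P) ↔
      f ∈ M K := by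
    intro f
    rw [IsLocalRing.mem_maximalIdeal, mem_nonunits_iff, not_iff_comm, notMem_M_iff]
    refine ⟨fun h => h.map _, fun h => ?_⟩
    rw [← notMem_M_iff]
    intro hf
    obtain ⟨u, hu⟩ := h.exists_right_inv
    obtain ⟨u, rfl⟩ := Ideal.Quotient.mk_surjective u
    rw [← map_mul, ← map_one (Ideal.Quotient.mk P), Ideal.Quotient.eq] at hu
    have h1 := sub_mem (Ideal.mul_mem_right u _ hf) (hle hu)
    rw [sub_sub_cancel] at h1
    exact (Ideal.ne_top_iff_one _).mp (Ideal.IsMaximal.ne_top inferInstance) h1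
  -- Regularity in dimension at most one bounds the cotangent space by one dimension, so the maximal
  -- ideal has a single generator `y`.
  have hprin : (IsLocalRing.maximalIdeal (PS K ⧸ P)).IsPrincipal := by
    rw [← IsLocalRing.finrank_cotangentSpace_le_one_iff]
    have := (IsRegularLocalRing.iff_finrank_cotangentSpace _).mp hreg
    rw [← this] at hdim
    exact_mod_cast hdim
  obtain ⟨y, hy⟩ := hprin.principal
  obtain ⟨y, rfl⟩ := Ideal.Quotient.mk_surjective y
  have hy0 : constantCoeff y = 0 := by
    rw [← mem_M_iff, ← hunit, hy]
    exact Submodule.mem_span_singleton_self _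
  have hX : ∀ s : Fin 3, ∃ t, X s - t * y ∈ P := by
    intro s
    have h1 := (hunit (X s)).mpr (X_mem_M s)
    rw [hy, Submodule.mem_span_singleton] at h1
    obtain ⟨t, ht⟩ := h1
    obtain ⟨t, rfl⟩ := Ideal.Quotient.mk_surjective t
    rw [smul_eq_mul, ← map_mul, eq_comm, Ideal.Quotient.eq] at ht
    exact ⟨t, ht⟩
  have hp := isXYPair_zero_one
  have key : ∀ f ∈ P, HasLinearPart f → ∃ H ∈ P, InXY H ∧ HasLinearPart H := by
    intro f hf hl
    have hd := X_two_dvd_sub hp f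
    refine ⟨extend hp (restrict hp f), ?_, inXY_extend _ _, ?_⟩
    · have := sub_mem hf (Ideal.mem_of_dvd _ hd hZ)
      rwa [sub_sub_cancel] at this
    · obtain ⟨q, hq⟩ := hd
      rw [show extend hp (restrict hp f) = f - X 2 * q by rw [← hq]; ring]
      simpa [HasLinearPart, coeff_single_one_mul, coeff_single_one_X] using hl
  obtain ⟨s, hs⟩ := hX 0
  obtain ⟨t, ht⟩ := hX 1
  -- If neither `X - s * y` nor `Y - t * y` had a linear part in `X, Y`, both `X` and `Y` would be
  -- multiples of the linear part of `y`, a single form.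
  by_contra hne
  have h1 : ¬ HasLinearPart (X 0 - s * y) := fun hl => hne (key _ hs hl)
  have h2 : ¬ HasLinearPart (X 1 - t * y) := fun hl => hne (key _ ht hl)
  simp only [HasLinearPart, not_or, not_not, map_sub, coeff_single_one_mul, hy0, mul_zero,
    add_zero, coeff_single_one_X, if_true, if_neg (one_ne_zero : (1 : Fin 3) ≠ 0),
    if_neg (zero_ne_one : (0 : Fin 3) ≠ 1)] at h1 h2
  have h3 : coeff (Finsupp.single 1 1) y = 0 := by
    linear_combination coeff (Finsupp.single 1 1) y * h1.1 -
      coeff (Finsupp.single 0 1) y * h1.2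
  rw [h3] at h2
  simpa using h2.2

/-- An element of the smooth equimultiple locus, other than the closed point, that is contained
in the plane `Z = 0` and not equal to it, is `(Z, H)` for a smooth plane curve `H`. -/
lemma exists_eq_span_pair {P : Ideal (PS K)} (hP : P.IsPrime)
    (hreg : IsRegularLocalRing (PS K ⧸ P)) (hdim : ringKrullDim (PS K ⧸ P) ≤ 1)
    (hZ : X 2 ∈ P) (hM : P ≠ M K) :
    ∃ H, InXY H ∧ constantCoeff H = 0 ∧ HasLinearPart H ∧ P = Ideal.span {X 2, H} := by
  obtain ⟨H, hHP, hH, hl⟩ := exists_mem_hasLinearPart hP hreg hdim hZ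
  have h0 := mem_M_iff.mp (le_M hP.ne_top hHP)
  obtain ⟨hp, -, hc⟩ := smooth_span_pair hH h0 hl
  refine ⟨H, hH, h0, hl, (hc.eq_or_eq_M hP ?_).resolve_right hM⟩
  rw [Ideal.span_le]
  rintro x (rfl | rfl) <;> assumption

end SmoothCurve

lemma var_ne_zero (s : Fin 3) : (X s : PS K) ≠ 0 :=
  nonZeroDivisors.ne_zero X_mem_nonzeroDivisors

/-! ### The quadratic substitution and the blowing down of curves. -/

section QuadraticSubstitution

variable (u : Fin 3 → K) (i : Fin 3)

/-- The quadratic substitution as a ring homomorphism. -/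
noncomputable def quadHom : PS K →+* PS K :=
  (substAlgHom (R := K) (hasSubst_quadSubst u i)).toRingHom

lemma quadHom_apply (f : PS K) : quadHom u i f = subst (quadSubst u i) f := by
  rw [← coe_substAlgHom (hasSubst_quadSubst u i)]
  rfl

lemma quadHom_X (s : Fin 3) : quadHom u i (X s) = quadSubst u i s := by
  rw [quadHom_apply, subst_X (hasSubst_quadSubst u i)]

lemma quadHom_X_self : quadHom u i (X i) = X i := by
  rw [quadHom_X, quadSubst, if_pos rfl]

lemma quadHom_X_of_ne {s : Fin 3} (hs : s ≠ i) :
    quadHom u i (X s) = X i * (X s + C (u s / u i)) := by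
  rw [quadHom_X, quadSubst, if_neg hs]

lemma quadHom_C (c : K) : quadHom u i (C c) = C c := by
  rw [quadHom_apply, subst_C]

variable {u i}

lemma X_dvd_quadSubst (s : Fin 3) : X i ∣ quadSubst u i s := by
  rw [quadSubst]
  split_ifs
  · exact dvd_rfl
  · exact dvd_mul_right _ _

lemma X_pow_dvd_quadHom {r : ℕ} {f : PS K} (hf : (r : ℕ∞) ≤ f.order) :
    X i ^ r ∣ quadHom u i f := by
  rw [← mem_M_pow_iff] at hf
  have h1 := Ideal.mem_map_of_mem (quadHom u i) hf
  rw [Ideal.map_pow] at h1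
  have h2 : (M K).map (quadHom u i) ≤ Ideal.span {X i} := by
    rw [M, Ideal.map_span, Ideal.span_le]
    rintro _ ⟨x, hx, rfl⟩
    rw [SetLike.mem_coe, Ideal.mem_span_singleton]
    rcases hx with rfl | rfl | rfl <;> (rw [quadHom_X]; exact X_dvd_quadSubst _)
  have h3 := Ideal.pow_right_mono h2 r h1
  rwa [Ideal.span_singleton_pow, Ideal.mem_span_singleton] at h3

lemma InXY.subst {a : Fin 3 → PS K} (ha : HasSubst a) (h : ∀ s ≠ 2, InXY (a s)) {f : PS K}
    (hf : InXY f) : InXY (MvPowerSeries.subst a f) := by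
  intro e he
  rw [coeff_subst ha]
  refine finsum_eq_zero_of_forall_eq_zero fun d => ?_
  by_cases hd : d 2 = 0
  · have : InXY (d.prod fun s e => a s ^ e) := by
      refine (xySubring K).prod_mem fun s hs => (h s ?_).pow _
      rintro rfl
      exact Finsupp.mem_support_iff.mp hs hd
    rw [this e he, smul_zero]
  · rw [hf d hd, zero_smul]

variable {j : Fin 3} (h : IsXYPair i j)

include h in
lemma InXY.quadHom {f : PS K} (hf : InXY f) : InXY (quadHom u i f) := by
  rw [quadHom_apply]
  refine hf.subst (hasSubst_quadSubst u i) fun s hs => ?_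
  rw [quadSubst]
  split_ifs
  · exact inXY_X h.2.1
  · exact (inXY_X h.2.1).mul ((inXY_X hs).add (inXY_C _))

lemma quadHom_extend_C (a : PowerSeries K) :
    quadHom u i (extend h (PowerSeries.C a)) = extend h (PowerSeries.C a) := by
  rw [quadHom_apply, subst_congr (hasSubst_quadSubst u i) HasSubst.X, subst_self, id]
  intro d hd s hs
  rw [coeff_extend, PowerSeries.coeff_C] at hd
  rcases h.cases s with rfl | rfl | rfl
  · rw [quadSubst, if_pos rfl]
  · simp [hs] at hd
  · simp [hs] at hd

/-- On polynomials in `X j` the substitution is composition with a polynomial of degree one, so it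
does not raise degrees; this controls remainders in `exists_blowDown`. -/
lemma quadHom_extend_coe (p : Polynomial (PowerSeries K)) :
    quadHom u i (extend h (p : PowerSeries (PowerSeries K))) =
      extend h ((p.comp (Polynomial.C PowerSeries.X *
        (Polynomial.X + Polynomial.C (PowerSeries.C (u j / u i))))) : Polynomial _) := by
  have : ((quadHom u i).comp (extend h)).comp Polynomial.coeToPowerSeries.ringHom =
      ((extend h).comp Polynomial.coeToPowerSeries.ringHom).comp
        (Polynomial.compRingHom (Polynomial.C PowerSeries.X *
          (Polynomial.X + Polynomial.C (PowerSeries.C (u j / u i))))) := by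
    apply Polynomial.ringHom_ext
    · intro a
      simp [quadHom_extend_C]
    · simp [quadHom_X_of_ne u i h.1.symm]
  exact congrArg (fun φ => φ p) this

include h in
/-- The transform of a curve `H` that is transversal to the fibre `X i = 0` comes from a curve. -/
lemma exists_blowDown {m : ℕ} {H : PS K} (hH : InXY H) (hm : IsRegularOfOrder m (restrict h H)) :
    ∃ H' G : PS K, InXY H' ∧ InXY G ∧ Associated H' H ∧ quadHom u i G = X i ^ m * H' ∧
      (m : ℕ∞) ≤ G.order ∧ IsRegularOfOrder m (restrict h G) ∧
      ∀ r a, InXY a → H' ∣ X i ^ r * quadHom u i a → G ∣ a := by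
  obtain ⟨f, hmonic, hdeg, hdist, hassoc⟩ := hm.exists_distinguished
  set c := u j / u i with hc
  -- `L` is chosen so that `π(L) = X i * X j`. Then `G` is the distinguished polynomial `f` of `H`,
  -- homogenized in `X i` and `L` with coefficients that `π` fixes.
  set L : PS K := X j - C c * X i with hL
  set G : PS K := ∑ l ∈ Finset.range (m + 1),
    extend h (PowerSeries.C (f.coeff l)) * X i ^ (m - l) * L ^ l with hG
  have hLXY : InXY L := (inXY_X h.2.2).sub ((inXY_C c).mul (inXY_X h.2.1))
  have hGXY : InXY G := InXY.sum fun l _ =>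
    ((inXY_extend h _).mul ((inXY_X h.2.1).pow _)).mul (hLXY.pow _)
  have hfsum : (f : PowerSeries (PowerSeries K)) =
      ∑ l ∈ Finset.range (m + 1), PowerSeries.C (f.coeff l) * PowerSeries.X ^ l := by
    have := congrArg Polynomial.coeToPowerSeries.ringHom f.as_sum_range_C_mul_X_pow
    rw [map_sum, hdeg] at this
    simpa using this
  have hπL : quadHom u i L = X i * X j := by
    rw [hL, map_sub, map_mul, quadHom_X_self, quadHom_X_of_ne u i h.1.symm, quadHom_C, hc]
    ring
  have hπ : quadHom u i G = X i ^ m * extend h (f : PowerSeries (PowerSeries K)) := by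
    rw [hG, hfsum, map_sum, map_sum, Finset.mul_sum]
    refine Finset.sum_congr rfl fun l hl => ?_
    have hl := Finset.mem_range.mp hl
    rw [map_mul, map_mul, map_pow, map_pow, quadHom_extend_C, quadHom_X_self, hπL, map_mul,
      map_pow, extend_X, show m = m - l + l by omega, pow_add, Nat.add_sub_cancel]
    ring
  have hLM : L ∈ M K := sub_mem (X_mem_M j) (Ideal.mul_mem_left _ _ (X_mem_M i))
  have hord : (m : ℕ∞) ≤ G.order := by
    rw [← mem_M_pow_iff]
    refine sum_mem fun l hl => ?_
    have hl := Finset.mem_range.mp hl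
    rw [mul_assoc, show m = m - l + l by omega, pow_add, Nat.add_sub_cancel]
    exact Ideal.mul_mem_left _ _ (Ideal.mul_mem_mul (Ideal.pow_mem_pow (X_mem_M i) _)
      (Ideal.pow_mem_pow hLM _))
  -- Modulo `X i`, only the top term survives and `G` becomes `X j ^ m`.
  have hGreg : IsRegularOfOrder m (restrict h G) := by
    have hdvd : X i ∣ G - X j ^ m := by
      rw [hG, Finset.sum_range_succ, Nat.sub_self, pow_zero, mul_one,
        show f.coeff m = 1 from hdeg ▸ hmonic.coeff_natDegree, map_one, map_one, one_mul,
        add_sub_assoc]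
      refine dvd_add (Finset.dvd_sum fun l hl => ?_) ?_
      · have hl := Finset.mem_range.mp hl
        exact Dvd.dvd.mul_right (Dvd.dvd.mul_left (dvd_pow_self _ (by omega)) _) _
      · refine dvd_trans ⟨-C c, ?_⟩ (sub_dvd_pow_sub_pow L (X j) m)
        rw [hL]; ring
    have hcoeff : ∀ l, coeff (xyExp i j 0 l) G = coeff (xyExp i j 0 l) (X j ^ m : PS K) := by
      intro l
      rw [← sub_eq_zero, ← map_sub]
      exact X_dvd_iff.mp hdvd _ (h.xyExp_fst _ _)
    classical
    have hX : ∀ l, xyExp i j 0 l = Finsupp.single j l := by simp [xyExp]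
    rw [isRegularOfOrder_restrict_iff]
    refine ⟨?_, fun l hl => ?_⟩
    · rw [hcoeff, coeff_X_pow, hX, if_pos rfl]
      exact one_ne_zero
    · rw [hcoeff, coeff_X_pow, hX, if_neg]
      intro e
      exact hl.ne (Finsupp.single_injective j e)
  refine ⟨extend h f, G, inXY_extend h _, hGXY, ?_, hπ, hord, hGreg, fun r a ha hdvd => ?_⟩
  · have := hassoc.map (extend h)
    rwa [hH.extend_restrict] at this
  -- The remainder `p` of `a` modulo `G` has degree less than `m`. So has its transform, a
  -- polynomial multiple of a power of `X i`; being divisible by `f` of degree `m`, it vanishes, and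
  -- then so does `p`.
  · obtain ⟨q, p, hp, haq⟩ := hGreg.exists_div (restrict h a)
    have hp0 : p = 0 := by
      by_contra hp0
      have h1 : extend h (p : PowerSeries (PowerSeries K)) = a - G * extend h q := by
        rw [← ha.extend_restrict h, haq, map_add, map_mul, hGXY.extend_restrict]
        ring
      have h2 : extend h (f : PowerSeries (PowerSeries K)) ∣
          X i ^ r * quadHom u i (extend h (p : PowerSeries (PowerSeries K))) := by
        rw [h1, map_sub, map_mul, hπ, mul_sub]
        exact dvd_sub hdvd ⟨X i ^ r * (X i ^ m * quadHom u i (extend h q)), by ring⟩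
      rw [quadHom_extend_coe h] at h2
      set t := Polynomial.C PowerSeries.X *
        (Polynomial.X + Polynomial.C (PowerSeries.C (u j / u i))) with ht
      have htdeg : t.natDegree = 1 := by
        rw [ht, Polynomial.natDegree_C_mul PowerSeries.X_ne_zero, Polynomial.natDegree_X_add_C]
      have h3 := map_dvd (restrict h) h2
      rw [map_mul, map_pow, restrict_X_fst, restrict_extend, restrict_extend,
        ← Polynomial.coe_C, ← Polynomial.coe_pow, ← Polynomial.coe_mul, ← Polynomial.C_pow] at h3
      have h4 := hm.eq_zero_of_dvd ?_ (hassoc.symm.dvd.trans h3)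
      · rw [mul_eq_zero, Polynomial.C_eq_zero, Polynomial.comp_eq_zero_iff] at h4
        rcases h4 with h4 | h4 | h4
        · exact pow_ne_zero r PowerSeries.X_ne_zero h4
        · exact hp0 h4
        · rw [h4.2, Polynomial.natDegree_C] at htdeg
          exact zero_ne_one htdeg
      · refine lt_of_le_of_lt Polynomial.degree_le_natDegree ?_
        refine lt_of_le_of_lt (b := (p.natDegree : WithBot ℕ)) ?_ ?_
        · refine Nat.cast_le.mpr (Polynomial.natDegree_C_mul_le _ _ |>.trans ?_)
          refine Polynomial.natDegree_comp_le.trans ?_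
          rw [htdeg, mul_one]
        · rwa [← Polynomial.degree_eq_natDegree hp0]
    rw [hp0, Polynomial.coe_zero, add_zero] at haq
    exact (hGXY.dvd_iff h ha).mp ⟨q, haq⟩

/-- If divisibility by `H` of the total transform implies divisibility by `G`, the same holds
for the powers. -/
lemma pow_dvd_of_pow_dvd_quadHom {m : ℕ} {H G : PS K} (hG : InXY G) (hH0 : H ≠ 0)
    (hπ : quadHom u i G = X i ^ m * H)
    (hdvd : ∀ r a, InXY a → H ∣ X i ^ r * quadHom u i a → G ∣ a) (s : ℕ) :
    ∀ r a, InXY a → H ^ s ∣ X i ^ r * quadHom u i a → G ^ s ∣ a := by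
  induction s with
  | zero => intro r a _ _; simp
  | succ s ih =>
    intro r a ha hs
    obtain ⟨a', ha', rfl⟩ := hG.exists_eq_mul_of_dvd ha
      (hdvd r a ha ((dvd_pow_self H (Nat.succ_ne_zero s)).trans hs))
    rw [pow_succ']
    -- Each factor `G` split off from `a` contributes `X i ^ m` to the transform; the free exponent
    -- `r` absorbs it.
    refine mul_dvd_mul_left G (ih (r + m) a' ha' ?_)
    rw [map_mul, hπ, pow_succ', show X i ^ r * (X i ^ m * H * quadHom u i a') =
      H * (X i ^ (r + m) * quadHom u i a') by ring] at hs
    exact (mul_dvd_mul_iff_left hH0).mp hs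

-- If `G` divides `x * y`, then `H` divides `π(x) * π(y)`, hence one of the factors, and this
-- divisibility descends to `G`.
include h in
lemma isPrime_span_pair_of_blowDown {m : ℕ} {H G : PS K} (hH : InXY H) (hG : InXY G)
    (hH0 : H ≠ 0) (hG0 : G ≠ 0) (hGM : G ∈ M K)
    (hπ : quadHom u i G = X i ^ m * H)
    (hdvd : ∀ r a, InXY a → H ∣ X i ^ r * quadHom u i a → G ∣ a)
    (hprime : (Ideal.span {X 2, H}).IsPrime) : (Ideal.span {X 2, G}).IsPrime := by
  rw [isPrime_span_pair_iff h hH hH0] at hprime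
  rw [isPrime_span_pair_iff h hG hG0]
  refine ⟨fun e => hG0 (hG.restrict_injective h (xySubring K).zero_mem (by rw [e, map_zero])),
    fun hu => ?_, fun x y hxy => ?_⟩
  · have := hu.map (extend h)
    rw [hG.extend_restrict] at this
    exact notMem_M_iff.mpr this hGM
  · have h1 := map_dvd (quadHom u i) (map_dvd (extend h) hxy)
    rw [hG.extend_restrict, hπ, map_mul, map_mul] at h1
    have h2 := map_dvd (restrict h) ((dvd_mul_left _ _).trans h1)
    rw [map_mul] at h2
    have key : ∀ z, restrict h H ∣ restrict h (quadHom u i (extend h z)) →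
        restrict h G ∣ z := by
      intro z hz
      rw [hH.dvd_iff h ((inXY_extend h z).quadHom h)] at hz
      have := map_dvd (restrict h) (hdvd 0 _ (inXY_extend h z) (by simpa using hz))
      rwa [restrict_extend] at this
    exact (hprime.dvd_or_dvd h2).imp (key x) (key y)

end QuadraticSubstitution

/-! ### The leading form of a coefficient and its trace on the exceptional divisor. -/

section LeadingForm

variable {i j : Fin 3} (h : IsXYPair i j)

lemma monomial_xyExp (i j : Fin 3) (a b : ℕ) (c : K) :
    monomial (xyExp i j a b) c = C c * X i ^ a * X j ^ b := by
  rw [X_pow_eq, X_pow_eq, ← monomial_zero_eq_C_apply, monomial_mul_monomial,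
    monomial_mul_monomial, xyExp, zero_add, mul_one, mul_one]

include h in
lemma succ_le_order_sub_leadingForm {r : ℕ} {a : PS K} (ha : InXY a) (hr : (r : ℕ∞) ≤ a.order) :
    ((r + 1 : ℕ) : ℕ∞) ≤ (a - ∑ l ∈ Finset.range (r + 1),
      monomial (xyExp i j (r - l) l) (coeff (xyExp i j (r - l) l) a)).order := by
  classical
  refine nat_le_order fun d hd => ?_
  rw [map_sub, map_sum]
  by_cases h2 : d 2 = 0
  · rw [h.degree, h2] at hd
    rcases (show d i + d j < r ∨ d i + d j = r by omega) with hlt | heq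
    · rw [coeff_of_lt_order (lt_of_lt_of_le _ hr), Finset.sum_eq_zero, sub_zero]
      · intro l hl
        have hl := Finset.mem_range.mp hl
        rw [coeff_monomial, if_neg]
        rintro rfl
        rw [h.xyExp_fst, h.xyExp_snd] at hlt
        omega
      · rw [h.degree, h2]
        exact_mod_cast hlt
    · rw [Finset.sum_eq_single (d j), coeff_monomial, show r - d j = d i by omega,
        ← h.eq_xyExp h2, if_pos rfl, sub_self]
      · intro l _ hl
        rw [coeff_monomial, if_neg]
        intro e
        exact hl (by rw [e, h.xyExp_snd])
      · intro hj
        exact absurd (Finset.mem_range.mpr (by omega)) hj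
  · rw [ha d h2, Finset.sum_eq_zero, sub_zero]
    intro l _
    rw [coeff_monomial, if_neg]
    rintro rfl
    exact h2 (h.xyExp_two _ _)

/-- Restriction to the line `X i = Z = 0`. -/
noncomputable def restrictLine : PS K →+* PowerSeries K :=
  (PowerSeries.map PowerSeries.constantCoeff).comp (restrict h)

lemma coeff_restrictLine (f : PS K) (l : ℕ) :
    PowerSeries.coeff l (restrictLine h f) = coeff (xyExp i j 0 l) f := by
  rw [restrictLine, RingHom.comp_apply, PowerSeries.coeff_map,
    ← PowerSeries.coeff_zero_eq_constantCoeff_apply, coeff_coeff_restrict]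

lemma restrictLine_X_fst : restrictLine h (X i : PS K) = 0 := by
  simp [restrictLine]

lemma restrictLine_X_snd : restrictLine h (X j : PS K) = PowerSeries.X := by
  simp [restrictLine]

lemma restrictLine_C (c : K) : restrictLine h (C c : PS K) = PowerSeries.C c := by
  rw [← extend_C_C h, restrictLine, RingHom.comp_apply, restrict_extend]
  simp

include h in
/-- If `a` has order `r` and the order of its transform `b` is at least `r`, then the restriction
of `b` to the exceptional divisor is a multiple of `X j ^ r`, and is not zero. -/
lemma coeff_ne_zero_of_quadHom_eq {u : Fin 3 → K} {r : ℕ} {a b : PS K} (ha : InXY a)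
    (har : a.order = r) (hab : quadHom u i a = X i ^ r * b) (hb : (r : ℕ∞) ≤ b.order) :
    coeff (xyExp i j 0 r) b ≠ 0 := by
  intro hb0
  set A : ℕ → K := fun l => coeff (xyExp i j (r - l) l) a with hA
  have hlead := succ_le_order_sub_leadingForm h ha har.ge
  set a' := a - ∑ l ∈ Finset.range (r + 1), monomial (xyExp i j (r - l) l) (A l) with ha'
  obtain ⟨b', hb'⟩ := X_pow_dvd_quadHom (u := u) (i := i) hlead
  -- On the exceptional divisor `b` is the dehomogenized leading form of `a`, translated by `u j / u
  -- i`: a polynomial `p` of degree at most `r`.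
  have hbsum : b = ∑ l ∈ Finset.range (r + 1), C (A l) * (X j + C (u j / u i)) ^ l +
      X i * b' := by
    refine mul_left_cancel₀ (pow_ne_zero r (var_ne_zero i)) ?_
    rw [← hab, show a = ∑ l ∈ Finset.range (r + 1), monomial (xyExp i j (r - l) l) (A l) + a' by
      rw [ha']; ring, map_add, hb', mul_add, map_sum, Finset.mul_sum]
    congr 1
    · refine Finset.sum_congr rfl fun l hl => ?_
      have hl := Finset.mem_range.mp hl
      rw [monomial_xyExp, map_mul, map_mul, map_pow, map_pow, quadHom_C, quadHom_X_self,
        quadHom_X_of_ne u i h.1.symm, show r = r - l + l by omega, pow_add, Nat.add_sub_cancel,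
        mul_pow]
      ring
    · ring
  set p : Polynomial K := ∑ l ∈ Finset.range (r + 1),
    Polynomial.C (A l) * (Polynomial.X + Polynomial.C (u j / u i)) ^ l with hp
  have hbp : restrictLine h b = (p : PowerSeries K) := by
    have : (p : PowerSeries K) = Polynomial.coeToPowerSeries.ringHom p := rfl
    rw [this, hbsum, hp]
    simp [restrictLine_X_fst, restrictLine_X_snd, restrictLine_C]
  have hpdeg : p.natDegree ≤ r := by
    refine Polynomial.natDegree_sum_le_of_forall_le _ _ fun l hl => ?_
    have hl := Finset.mem_range.mp hl
    refine (Polynomial.natDegree_C_mul_le _ _).trans (Polynomial.natDegree_pow_le.trans ?_)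
    rw [Polynomial.natDegree_X_add_C]
    omega
  -- Coefficients below `r` vanish by the order of `b`, the one at `r` by assumption, those above by
  -- degree. Undoing the translation then kills the leading form of `a`.
  have hp0 : p = 0 := by
    ext l
    rw [Polynomial.coeff_zero]
    rcases lt_trichotomy l r with hl | rfl | hl
    · rw [← Polynomial.coeff_coe, ← hbp, coeff_restrictLine]
      refine coeff_of_lt_order (lt_of_lt_of_le ?_ hb)
      rw [h.degree, h.xyExp_fst, h.xyExp_snd, h.xyExp_two]
      simpa using hl
    · rw [← Polynomial.coeff_coe, ← hbp, coeff_restrictLine, hb0]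
    · exact Polynomial.coeff_eq_zero_of_natDegree_lt (lt_of_le_of_lt hpdeg hl)
  have hA0 : ∀ l ∈ Finset.range (r + 1), A l = 0 := by
    intro l hl
    have h1 := congrArg (fun q => q.comp (Polynomial.X - Polynomial.C (u j / u i))) hp0
    have h2 : ∑ l ∈ Finset.range (r + 1), Polynomial.C (A l) * Polynomial.X ^ l = 0 := by
      simpa [hp] using h1
    have h3 := congrArg (fun q => q.coeff l) h2
    simpa [Polynomial.finsetSum_coeff, Polynomial.coeff_C_mul, Polynomial.coeff_X_pow,
      Finset.mem_range.mp hl] using h3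
  rw [ha', Finset.sum_eq_zero fun l hl => by rw [hA0 l hl, map_zero], sub_zero, har] at hlead
  have : r + 1 ≤ r := by exact_mod_cast hlead
  omega

end LeadingForm

/-! ### The chart in which `Z` is privileged contains no point of multiplicity `n`. -/

section VerticalDirection

/-- The degree is at most `n`, so the polynomial would be a constant times `X ^ n`. Every exponent
`n - k` is at least `2`, so at `-1` the value is `1` and the derivative `0`, whereas a nonzero
multiple of `X ^ n` has nonzero derivative there. -/
lemma not_X_pow_dvd_one_add_sum [CharZero K] {n : ℕ} (hn : 1 ≤ n) (B : ℕ → K) :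
    ¬ Polynomial.X ^ n ∣ (1 + ∑ k ∈ Finset.range (n - 1),
      Polynomial.C (B k) * (Polynomial.X + 1) ^ (n - k) : Polynomial K) := by
  rintro ⟨q, hq⟩
  set p := (1 + ∑ k ∈ Finset.range (n - 1),
      Polynomial.C (B k) * (Polynomial.X + 1) ^ (n - k) : Polynomial K) with hp
  have hdeg : p.natDegree ≤ n := by
    refine (Polynomial.natDegree_add_le _ _).trans (max_le (by simp) ?_)
    refine Polynomial.natDegree_sum_le_of_forall_le _ _ fun k _ => ?_
    refine (Polynomial.natDegree_C_mul_le _ _).trans (Polynomial.natDegree_pow_le.trans ?_)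
    rw [← Polynomial.C_1, Polynomial.natDegree_X_add_C]
    omega
  have hev : p.eval (-1) = 1 := by
    rw [hp, Polynomial.eval_add, Polynomial.eval_one, Polynomial.eval_finsetSum,
      Finset.sum_eq_zero, add_zero]
    intro k hk
    have hk := Finset.mem_range.mp hk
    simp [show n - k ≠ 0 by omega]
  have hder : p.derivative.eval (-1) = 0 := by
    rw [hp, Polynomial.derivative_add, Polynomial.derivative_one, zero_add,
      Polynomial.derivative_sum, Polynomial.eval_finsetSum]
    refine Finset.sum_eq_zero fun k hk => ?_
    have hk := Finset.mem_range.mp hk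
    simp [Polynomial.derivative_pow, show n - k - 1 ≠ 0 by omega]
  have hq0 : q ≠ 0 := by
    rintro rfl
    rw [hq, mul_zero, Polynomial.eval_zero] at hev
    exact zero_ne_one hev
  rw [hq, Polynomial.natDegree_mul (pow_ne_zero n Polynomial.X_ne_zero) hq0,
    Polynomial.natDegree_X_pow] at hdeg
  rw [Polynomial.eq_C_of_natDegree_eq_zero (show q.natDegree = 0 by omega)] at hq
  rw [hq] at hev hder
  have hn0 : (n : K) ≠ 0 := by exact_mod_cast (show n ≠ 0 by omega)
  have h1 : q.coeff 0 = 0 := by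
    simpa [Polynomial.derivative_mul, Polynomial.derivative_X_pow, hn0] using hder
  rw [h1] at hev
  simp at hev

/-- The evaluation of power series along the line spanned by `(c, c', 0)`. -/
lemma exists_evalLine (c c' : K) : ∃ τ : PS K →+* PowerSeries K, τ (X 0) = PowerSeries.C c *
    PowerSeries.X ∧ τ (X 1) = PowerSeries.C c' * PowerSeries.X ∧ τ (X 2) = 0 ∧
      ∀ b, τ (C b) = PowerSeries.C b := by
  let a : Fin 3 → MvPowerSeries Unit K := ![C c * X (), C c' * X (), 0]
  have ha : HasSubst a := by
    apply hasSubst_of_constantCoeff_zero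
    intro s
    fin_cases s <;> simp [a]
  refine ⟨(substAlgHom (R := K) ha).toRingHom, substAlgHom_X ha 0, substAlgHom_X ha 1,
    substAlgHom_X ha 2, fun b => ?_⟩
  exact (congrFun (coe_substAlgHom ha) _).trans (subst_C b)

/-- Along the line `t ↦ (c t, c' t, 0)` with `c = u 0 / u 2`, `c' = u 1 / u 2`, both `X + c` and `Y
+ c'` are multiples of `t + 1`. So `F₁` restricts to `1 + ∑ B_k (t + 1) ^ (n - k)`, where `B_k` is
the degree `n - k` form of `a k` at `(c, c')`, and order `n` would make `t ^ n` divide it. -/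
lemma not_isQuadraticTransform_two [CharZero K] {n : ℕ} {a : ℕ → PS K} {F F₁ : PS K}
    (h : HasWeierstrassCoeffs n a F) {u : Fin 3 → K} (hF₁ : IsQuadraticTransform u 2 F F₁)
    (hord : (n : ℕ∞) ≤ F₁.order) : False := by
  have hp := isXYPair_zero_one
  set A : ℕ → ℕ → K := fun k l => coeff (xyExp 0 1 (n - k - l) l) (a k) with hA
  have hb : ∀ k, ∃ b', k < n - 1 → quadHom u 2 (a k) = X 2 ^ (n - k) *
      (∑ l ∈ Finset.range (n - k + 1), C (A k l) * (X 0 + C (u 0 / u 2)) ^ (n - k - l) *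
        (X 1 + C (u 1 / u 2)) ^ l + X 2 * b') := by
    intro k
    by_cases hk : k < n - 1
    · have hlead := succ_le_order_sub_leadingForm hp (h.2.1 k hk).1 (h.2.1 k hk).2
      obtain ⟨b', hb'⟩ := X_pow_dvd_quadHom (u := u) (i := 2) hlead
      refine ⟨b', fun _ => ?_⟩
      rw [map_sub, map_sum, sub_eq_iff_eq_add] at hb'
      rw [hb', mul_add, add_comm, Finset.mul_sum]
      congr 1
      · refine Finset.sum_congr rfl fun l hl => ?_
        have hl := Finset.mem_range.mp hl
        rw [monomial_xyExp, map_mul, map_mul, map_pow, map_pow, quadHom_C,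
          quadHom_X_of_ne u 2 (by decide), quadHom_X_of_ne u 2 (by decide)]
        conv_rhs => rw [show X 2 ^ (n - k) = (X 2 ^ (n - k - l) * X 2 ^ l : PS K) by
          rw [← pow_add]; congr 1; omega]
        rw [mul_pow, mul_pow]
        ring
      · ring
    · exact ⟨0, fun h => absurd h hk⟩
  choose b' hb' using hb
  have hF : F₁ = 1 + ∑ k ∈ Finset.range (n - 1), (∑ l ∈ Finset.range (n - k + 1),
      C (A k l) * (X 0 + C (u 0 / u 2)) ^ (n - k - l) * (X 1 + C (u 1 / u 2)) ^ l +
        X 2 * b' k) := by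
    rw [IsQuadraticTransform, h.mult_eq, h.2.2, ← quadHom_apply, map_add, map_pow, map_sum,
      quadHom_X_self] at hF₁
    refine mul_left_cancel₀ (pow_ne_zero n (var_ne_zero 2)) ?_
    rw [← hF₁, mul_add, mul_one, Finset.mul_sum]
    congr 1
    refine Finset.sum_congr rfl fun k hk => ?_
    have hk := Finset.mem_range.mp hk
    rw [map_mul, map_pow, quadHom_X_self, hb' k hk]
    conv_rhs => rw [show X 2 ^ n = (X 2 ^ (n - k) * X 2 ^ k : PS K) by
      rw [← pow_add]; congr 1; omega]
    ring
  obtain ⟨τ, h0, h1, h2, hC⟩ := exists_evalLine (u 0 / u 2) (u 1 / u 2)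
  have hdvd : PowerSeries.X ^ n ∣ τ F₁ := by
    have h3 := Ideal.mem_map_of_mem τ (mem_M_pow_iff.mpr hord)
    rw [Ideal.map_pow] at h3
    have h4 : (M K).map τ ≤ Ideal.span {PowerSeries.X} := by
      rw [M, Ideal.map_span, Ideal.span_le]
      rintro _ ⟨x, hx, rfl⟩
      rw [SetLike.mem_coe, Ideal.mem_span_singleton]
      rcases hx with rfl | rfl | rfl
      · rw [h0]; exact dvd_mul_left _ _
      · rw [h1]; exact dvd_mul_left _ _
      · rw [h2]; exact dvd_zero _
    have h5 := Ideal.pow_right_mono h4 n h3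
    rwa [Ideal.span_singleton_pow, Ideal.mem_span_singleton] at h5
  refine not_X_pow_dvd_one_add_sum h.1 (fun k => ∑ l ∈ Finset.range (n - k + 1),
    A k l * (u 0 / u 2) ^ (n - k - l) * (u 1 / u 2) ^ l) ?_
  rw [Polynomial.X_pow_dvd_iff]
  rw [PowerSeries.X_pow_dvd_iff] at hdvd
  intro d hd
  rw [← hdvd d hd, ← Polynomial.coeff_coe]
  congr 1
  have hcoe : ∀ p : Polynomial K,
    (p : PowerSeries K) = Polynomial.coeToPowerSeries.ringHom p := fun _ => rfl
  rw [hcoe, hF]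
  simp only [map_add, map_one, map_sum, map_mul, map_pow, h0, h1, h2, hC, zero_mul, add_zero,
    Polynomial.coeToPowerSeries.ringHom_apply, Polynomial.coe_C, Polynomial.coe_X]
  congr 1
  refine Finset.sum_congr rfl fun k _ => ?_
  rw [Finset.sum_mul]
  refine Finset.sum_congr rfl fun l hl => ?_
  have hl := Finset.mem_range.mp hl
  conv_lhs => rw [show (PowerSeries.X + 1 : PowerSeries K) ^ (n - k) =
    (PowerSeries.X + 1) ^ (n - k - l) * (PowerSeries.X + 1) ^ l by
      rw [← pow_add]; congr 1; omega]
  rw [show PowerSeries.C (u 0 / u 2) * PowerSeries.X + PowerSeries.C (u 0 / u 2) =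
      PowerSeries.C (u 0 / u 2) * (PowerSeries.X + 1) by ring,
    show PowerSeries.C (u 1 / u 2) * PowerSeries.X + PowerSeries.C (u 1 / u 2) =
      PowerSeries.C (u 1 / u 2) * (PowerSeries.X + 1) by ring, mul_pow, mul_pow]
  ring

end VerticalDirection

/-! ### The tangent cone. -/

section TangentCone

/-- The initial form is then `Z ^ n`. Used in contrapositive form: a cone that is not a plane
provides some `a k` of order exactly `n - k`. -/
lemma tangentConeIsPlane_of_lt_order [CharZero K] {n : ℕ} {a : ℕ → PS K} {F : PS K}
    (h : HasWeierstrassCoeffs n a F)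
    (ha : ∀ k < n - 1, ((n - k + 1 : ℕ) : ℕ∞) ≤ (a k).order) : TangentConeIsPlane F := by
  classical
  have hinit : initialForm F = MvPolynomial.X 2 ^ n := by
    ext d
    rw [initialForm, h.mult_eq, coeff_truncTotal_eq_ite, coeff_homogeneousComponent,
      MvPolynomial.coeff_X_pow]
    by_cases hd : d.degree = n
    · rw [if_pos (by omega), if_pos hd, h.2.2, map_add, map_sum, Finset.sum_eq_zero, add_zero,
        coeff_X_pow]
      · simp only [eq_comm]
      · intro k hk
        have hk := Finset.mem_range.mp hk
        refine coeff_of_lt_order ?_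
        rw [order_mul, hd]
        have h1 : ((k : ℕ) : ℕ∞) ≤ (X 2 ^ k : PS K).order :=
          mem_M_pow_iff.mp (Ideal.pow_mem_pow (X_mem_M 2) k)
        refine lt_of_lt_of_le ?_ (add_le_add (ha k hk) h1)
        norm_cast
        omega
    · rw [if_neg hd, ite_self, if_neg]
      rintro rfl
      exact hd (Finsupp.degree_single _ _)
  refine ⟨LinearMap.ker (LinearMap.proj 2 : (Fin 3 → K) →ₗ[K] K), ?_, ?_⟩
  · have h1 := LinearMap.finrank_range_add_finrank_ker
      (LinearMap.proj 2 : (Fin 3 → K) →ₗ[K] K)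
    rw [LinearMap.range_eq_top.mpr (LinearMap.proj_surjective 2), finrank_top,
      Module.finrank_self, Module.finrank_fin_fun] at h1
    omega
  · ext v
    simp [tangentCone, hinit, show n ≠ 0 from by have := h.1; omega]

end TangentCone

/-! ### Tangency and transversality read off the linear part. -/

section ExceptionalDivisor

variable {i j : Fin 3} (h : IsXYPair i j)

lemma self_mem_span_pair (G : PS K) : G ∈ Ideal.span {X 2, G} := Ideal.subset_span (by simp)

lemma X_two_mem_span_pair (G : PS K) : X 2 ∈ Ideal.span {X 2, G} := Ideal.subset_span (by simp)

lemma span_pair_congr {G H : PS K} (hGH : Associated G H) :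
    Ideal.span {X 2, G} = Ideal.span {X 2, H} := by
  rw [Ideal.span_insert, Ideal.span_insert, le_antisymm
    (Ideal.span_singleton_le_span_singleton.mpr hGH.symm.dvd)
    (Ideal.span_singleton_le_span_singleton.mpr hGH.dvd)]

-- In one direction, linear coefficients at `X j` are compared in `X j ∈ (Z, H, X i)`. In the other,
-- preparation turns `H` into `X j + X i * q` up to a unit.
include h in
lemma isTransversal_span_pair_iff {H : PS K} (hH : InXY H) :
    IsTransversal i (Ideal.span {X 2, H}) ↔
      constantCoeff H = 0 ∧ coeff (Finsupp.single j 1) H ≠ 0 := by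
  rw [IsTransversal]
  constructor
  · intro he
    have hHM : H ∈ M K := he ▸ Ideal.mem_sup_left (self_mem_span_pair H)
    have hXj : X j ∈ Ideal.span {X 2, H} ⊔ Ideal.span {X i} := he ▸ X_mem_M j
    rw [mem_M_iff] at hHM
    refine ⟨hHM, fun h0 => ?_⟩
    obtain ⟨y, hy, z, hz, hyz⟩ := Submodule.mem_sup.mp hXj
    obtain ⟨α, β, rfl⟩ := Ideal.mem_span_pair.mp hy
    obtain ⟨γ, rfl⟩ := Ideal.mem_span_singleton.mp hz
    have := congrArg (coeff (Finsupp.single j 1)) hyz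
    simp [coeff_single_one_mul, coeff_single_one_X, h0, hHM, h.1.symm, h.2.2] at this
  · rintro ⟨h0, hj⟩
    apply le_antisymm
    · refine sup_le ?_ ?_
      · rw [Ideal.span_le]
        rintro x (rfl | rfl)
        · exact X_mem_M 2
        · exact mem_M_iff.mpr h0
      · rw [Ideal.span_singleton_le_iff_mem]
        exact X_mem_M i
    · have hXi : X i ∈ Ideal.span {X 2, H} ⊔ Ideal.span {X i} :=
        Ideal.mem_sup_right (Ideal.mem_span_singleton_self _)
      have hX2 : X 2 ∈ Ideal.span {X 2, H} ⊔ Ideal.span {X i} :=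
        Ideal.mem_sup_left (X_two_mem_span_pair H)
      have hXj : X j ∈ Ideal.span {X 2, H} ⊔ Ideal.span {X i} := by
        obtain ⟨f, hf, hdeg, hf0, hassoc⟩ :=
          (isRegularOfOrder_one_restrict h h0 hj).exists_distinguished
        obtain ⟨q, hq⟩ := hf0 0 one_pos
        have hf1 : f = Polynomial.X + Polynomial.C (f.coeff 0) := hf.eq_X_add_C hdeg
        have h1 : extend h (f : PowerSeries (PowerSeries K)) ∈ Ideal.span {X 2, H} := by
          rw [mem_span_pair_iff h _ hH, restrict_extend]
          exact hassoc.symm.dvd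
        have h2 : (X j : PS K) = extend h (f : PowerSeries (PowerSeries K)) -
            X i * extend h (PowerSeries.C q) := by
          rw [hf1, hq, Polynomial.coe_add, Polynomial.coe_X, Polynomial.coe_C, map_add, map_mul,
            map_mul, extend_X, extend_C_X]
          ring
        rw [h2]
        exact sub_mem (Ideal.mem_sup_left h1) (Ideal.mul_mem_right _ _ hXi)
      rw [M, Ideal.span_le]
      have key : ∀ s : Fin 3, (X s : PS K) ∈ Ideal.span {X 2, H} ⊔ Ideal.span {X i} := by
        intro s
        rcases h.cases s with rfl | rfl | rfl <;> assumption
      rintro x (rfl | rfl | rfl) <;> exact key _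

lemma coeff_single_one_of_mem_M_sq {f : PS K} (hf : f ∈ M K ^ 2) (s : Fin 3) :
    coeff (Finsupp.single s 1) f = 0 := by
  refine coeff_of_lt_order (lt_of_lt_of_le ?_ (mem_M_pow_iff.mp hf))
  rw [Finsupp.degree_single]
  norm_cast

lemma coeff_ne_zero_of_isTangent {H : PS K} (h0 : constantCoeff H = 0) (hi : i ≠ 2)
    (ht : IsTangent i (Ideal.span {X 2, H})) : coeff (Finsupp.single i 1) H ≠ 0 := by
  intro hHi
  obtain ⟨y, hy, z, hz, hyz⟩ := Submodule.mem_sup.mp ht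
  obtain ⟨α, β, rfl⟩ := Ideal.mem_span_pair.mp hy
  have := congrArg (coeff (Finsupp.single i 1)) hyz
  simp [coeff_single_one_mul, coeff_single_one_X, h0, hHi, coeff_single_one_of_mem_M_sq hz,
    hi] at this

include h in
lemma isTangent_span_pair {H : PS K} (hH : InXY H) (h0 : constantCoeff H = 0)
    (hi : coeff (Finsupp.single i 1) H ≠ 0) (hj : coeff (Finsupp.single j 1) H = 0) :
    IsTangent i (Ideal.span {X 2, H}) := by
  set t := C (coeff (Finsupp.single i 1) H)⁻¹ * H with ht
  have h1 : X i - t ∈ M K ^ 2 := by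
    rw [mem_M_pow_iff]
    refine nat_le_order fun d hd => ?_
    by_cases h2 : d 2 = 0
    · rw [h.degree, h2] at hd
      rw [h.eq_xyExp h2]
      rcases (show (d i = 0 ∧ d j = 0) ∨ (d i = 1 ∧ d j = 0) ∨ (d i = 0 ∧ d j = 1) by omega)
        with ⟨e1, e2⟩ | ⟨e1, e2⟩ | ⟨e1, e2⟩ <;> rw [e1, e2]
      · simp [xyExp_zero_zero, ht, h0]
      · rw [show xyExp i j 1 0 = Finsupp.single i 1 by simp [xyExp]]
        simp [ht, hi]
      · simp [xyExp_zero_one, ht, coeff_single_one_X, hj, h.1.symm]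
    · exact ((inXY_X h.2.1).sub ((inXY_C _).mul hH)) d h2
  rw [IsTangent, show (X i : PS K) = t + (X i - t) by ring]
  exact Submodule.add_mem_sup (Ideal.mul_mem_left _ _ (self_mem_span_pair H)) h1

include h in
lemma associated_X_of_dvd {H : PS K} (hd : X i ∣ H) (hl : HasLinearPart H) :
    Associated (X i) H := by
  obtain ⟨w, rfl⟩ := hd
  refine associated_mul_unit_right _ _ ?_
  rw [← notMem_M_iff, mem_M_iff]
  intro hw
  rw [hasLinearPart_iff h] at hl
  simp [coeff_single_one_mul, hw] at hl

end ExceptionalDivisor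

/-! ### Smooth equimultiple curves under quadratic transforms. -/

section QuadraticTransform

variable {i j : Fin 3} (h : IsXYPair i j) {u : Fin 3 → K} {n : ℕ} {a b : ℕ → PS K} {F F₁ : PS K}

include h in
lemma IsQuadraticTransform.exists_coeffs [CharZero K] (hF : HasWeierstrassCoeffs n a F)
    (hF₁ : IsQuadraticTransform u i F F₁) (hord : F₁.order = F.order) :
    ∃ b, HasWeierstrassCoeffs n b F₁ ∧
      ∀ k < n - 1, quadHom u i (a k) = X i ^ (n - k) * b k := by
  have hb : ∀ k, ∃ b, InXY b ∧ (k < n - 1 → quadHom u i (a k) = X i ^ (n - k) * b) := by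
    intro k
    by_cases hk : k < n - 1
    · obtain ⟨b, hb⟩ := X_pow_dvd_quadHom (u := u) (i := i) (hF.2.1 k hk).2
      refine ⟨b, InXY.of_mul_X_pow h.2.1 (n := n - k) ?_, fun _ => hb⟩
      rw [← hb]
      exact (hF.2.1 k hk).1.quadHom h
    · exact ⟨0, (xySubring K).zero_mem, fun h => absurd h hk⟩
  choose b hbXY hb using hb
  refine ⟨b, (hasWeierstrassCoeffs_of_le_order hF.1 (fun k _ => hbXY k) (c := u 2 / u i) ?_
    (by rw [hord, hF.order_eq])).2, hb⟩
  rw [IsQuadraticTransform, hF.mult_eq, hF.2.2, subst_weierstrass (hasSubst_quadSubst u i)] at hF₁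
  refine mul_left_cancel₀ (pow_ne_zero n (var_ne_zero i)) ?_
  rw [← mul_pow_weierstrass, ← hF₁]
  have h2 : quadSubst u i 2 = X i * (X 2 + C (u 2 / u i)) := by
    rw [quadSubst, if_neg h.2.1.symm]
  rw [h2]
  congr 1
  refine Finset.sum_congr rfl fun k hk => ?_
  rw [← quadHom_apply, hb k (Finset.mem_range.mp hk)]

lemma HasWeierstrassCoeffs.mem_equimultipleLocus_of_dvd [CharZero K]
    (hF : HasWeierstrassCoeffs n a F) {G : PS K} (hp : (Ideal.span {X 2, G}).IsPrime)
    (hd : ∀ k < n - 1, G ^ (n - k) ∣ a k) : Ideal.span {X 2, G} ∈ equimultipleLocus F := by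
  refine hF.mem_equimultipleLocus_iff.mpr ⟨hp, X_two_mem_span_pair G, fun k hk => ?_⟩
  exact Ideal.mem_of_dvd _ (hd k hk)
    (mem_symbolicPower_of_mem_pow (Ideal.pow_mem_pow (self_mem_span_pair G) _))

lemma HasWeierstrassCoeffs.mem_smoothLocus_of_dvd [CharZero K]
    (hF : HasWeierstrassCoeffs n a F) {G : PS K} (hG : InXY G) (hG0 : constantCoeff G = 0)
    (hGl : HasLinearPart G) (hd : ∀ k < n - 1, G ^ (n - k) ∣ a k) :
    Ideal.span {X 2, G} ∈ smoothLocus F := by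
  obtain ⟨hp, hr, -⟩ := smooth_span_pair hG hG0 hGl
  exact ⟨hF.mem_equimultipleLocus_of_dvd hp hd, hr⟩

lemma HasWeierstrassCoeffs.pow_dvd [CharZero K]
    (hF : HasWeierstrassCoeffs n a F) {G : PS K} (hG : InXY G) (hG0 : G ≠ 0)
    (hP : Ideal.span {X 2, G} ∈ equimultipleLocus F) :
    constantCoeff G = 0 ∧ ∀ k < n - 1, G ^ (n - k) ∣ a k := by
  obtain ⟨hp, -, hd⟩ := hF.mem_equimultipleLocus_iff.mp hP
  refine ⟨mem_M_iff.mp (le_M hp.ne_top (self_mem_span_pair G)), fun k hk => ?_⟩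
  exact (mem_symbolicPower_span_pair_iff hG hG0 (hF.2.1 k hk).1).mp (hd k hk)

/-- The coefficients of the transform are divisible by the powers of the transform of an
equimultiple curve. -/
lemma pow_dvd_of_quadHom_eq {r s : ℕ} (hs : 1 ≤ s) {G G₁ x y : PS K}
    (hGx : G ^ r ∣ x) (hπG : quadHom u i G = X i ^ s * G₁)
    (hπx : quadHom u i x = X i ^ r * y) : X i ^ (r * (s - 1)) * G₁ ^ r ∣ y := by
  obtain ⟨e, rfl⟩ := hGx
  refine ⟨quadHom u i e, mul_left_cancel₀ (pow_ne_zero r (var_ne_zero i)) ?_⟩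
  rw [← hπx, map_mul, map_pow, hπG, mul_pow, ← pow_mul,
    -- Of the `s * r` factors `X i` in `π(G ^ r)`, the transform of the coefficient uses up `r`.
    show s * r = r + r * (s - 1) by obtain ⟨t, rfl⟩ := Nat.exists_eq_add_of_le hs; simp; ring,
    pow_add]
  ring

-- Equimultiplicity descends: `H ^ (n - k)` divides the new coefficients, so `G ^ (n - k)` divides
-- the old ones. The order of `G` is exactly `m` because `X j ^ m` occurs in it.
include h in
lemma exists_blowDown_of_mem [CharZero K] (hF : HasWeierstrassCoeffs n a F)
    (hF₁ : HasWeierstrassCoeffs n b F₁)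
    (hab : ∀ k < n - 1, quadHom u i (a k) = X i ^ (n - k) * b k) {H : PS K} (hH : InXY H)
    (hHi : ¬ X i ∣ H) (hP : Ideal.span {X 2, H} ∈ equimultipleLocus F₁) :
    ∃ (m : ℕ) (G : PS K), 1 ≤ m ∧ InXY G ∧ constantCoeff G = 0 ∧ G.order = m ∧
      IsRegularOfOrder m (restrict h H) ∧ IsRegularOfOrder m (restrict h G) ∧
      Ideal.span {X 2, G} ∈ equimultipleLocus F ∧ (∀ k < n - 1, G ^ (n - k) ∣ a k) ∧
      IsQuadraticTransformIdeal u i (Ideal.span {X 2, G}) (Ideal.span {X 2, H}) := by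
  have hH0 : H ≠ 0 := by rintro rfl; exact hHi (dvd_zero _)
  obtain ⟨hHc, hHd⟩ := hF₁.pow_dvd hH hH0 hP
  obtain ⟨m, hm⟩ := exists_isRegularOfOrder (g := restrict h H) (by
    rwa [← restrict_X_fst h, (inXY_X h.2.1).dvd_iff h hH])
  obtain ⟨H', G, hH', hG, hassoc, hπ, hord, hGm, hdvd⟩ := exists_blowDown h (u := u) hH hm
  have hm1 : 1 ≤ m := by
    rw [Nat.one_le_iff_ne_zero]
    rintro rfl
    rw [isRegularOfOrder_restrict_iff, xyExp_zero_zero] at hm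
    exact hm.1 hHc
  have hGord : G.order = m := by
    refine le_antisymm ?_ hord
    rw [isRegularOfOrder_restrict_iff] at hGm
    refine (order_le hGm.1).trans ?_
    rw [h.degree, h.xyExp_fst, h.xyExp_snd, h.xyExp_two]
    simp
  have hG0 : G ≠ 0 := by
    rintro rfl
    rw [order_zero] at hGord
    exact ENat.top_ne_natCast m hGord
  have hGc : constantCoeff G = 0 := by
    rw [← one_le_order_iff_constCoeff_eq_zero]
    exact le_trans (by exact_mod_cast hm1) hord
  have hH'0 : H' ≠ 0 := hassoc.ne_zero_iff.mpr hH0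
  rw [← span_pair_congr hassoc] at hP ⊢
  have hd : ∀ k < n - 1, G ^ (n - k) ∣ a k := by
    intro k hk
    refine pow_dvd_of_pow_dvd_quadHom hG hH'0 hπ hdvd (n - k) 0 (a k) (hF.2.1 k hk).1 ?_
    rw [pow_zero, one_mul, hab k hk]
    exact dvd_mul_of_dvd_right ((hF₁.pow_dvd hH' hH'0 hP).2 k hk) _
  obtain ⟨hp, -⟩ := hP
  refine ⟨m, G, hm1, hG, hGc, hGord, hm, hGm, hF.mem_equimultipleLocus_of_dvd
    (isPrime_span_pair_of_blowDown h hH' hG hH'0 hG0 (mem_M_iff.mpr hGc) hπ hdvd hp) hd, hd,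
    G, H', hG, hG0, rfl, ?_, rfl⟩
  rw [← quadHom_apply, hπ, hGord, ENat.toNat_natCast]

include h in
lemma exists_generator_of_isQuadraticTransformIdeal [CharZero K] (hF : HasWeierstrassCoeffs n a F)
    (hab : ∀ k < n - 1, quadHom u i (a k) = X i ^ (n - k) * b k) {Q P : Ideal (PS K)}
    (hQ : Q ∈ equimultipleLocus F) (hQP : IsQuadraticTransformIdeal u i Q P) :
    ∃ (s : ℕ) (G G₁ : PS K), 1 ≤ s ∧ InXY G ∧ InXY G₁ ∧ constantCoeff G = 0 ∧ G.order = s ∧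
      Q = Ideal.span {X 2, G} ∧ P = Ideal.span {X 2, G₁} ∧ quadHom u i G = X i ^ s * G₁ ∧
      (∀ k < n - 1, G ^ (n - k) ∣ a k) ∧
      ∀ k < n - 1, X i ^ ((n - k) * (s - 1)) * G₁ ^ (n - k) ∣ b k := by
  obtain ⟨G, G₁, hG, hGne, rfl, hπ, rfl⟩ := hQP
  rw [← quadHom_apply] at hπ
  obtain ⟨hG0, hGd⟩ := hF.pow_dvd hG hGne hQ
  obtain ⟨s, hs⟩ := ENat.ne_top_iff_exists.mp (fun e => hGne (order_eq_top_iff.mp e))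
  rw [← hs, ENat.toNat_natCast] at hπ
  have hs1 : 1 ≤ s := by
    have := one_le_order_iff_constCoeff_eq_zero.mpr hG0
    rw [← hs] at this
    exact_mod_cast this
  refine ⟨s, G, G₁, hs1, hG, InXY.of_mul_X_pow h.2.1 (n := s) ?_, hG0, hs.symm, rfl, rfl, hπ, hGd,
    fun k hk => pow_dvd_of_quadHom_eq hs1 (hGd k hk) hπ (hab k hk)⟩
  rw [← hπ]
  exact hG.quadHom h

lemma constantCoeff_quadHom (f : PS K) : constantCoeff (quadHom u i f) = constantCoeff f := by
  have h1 : quadHom u i (f - C (constantCoeff f)) ∈ M K := by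
    have h2 : f - C (constantCoeff f) ∈ M K := by simp [mem_M_iff]
    have h3 : ∀ s, quadHom u i (X s) ∈ M K := by
      intro s
      by_cases hs : s = i
      · rw [hs, quadHom_X_self]
        exact X_mem_M i
      · rw [quadHom_X_of_ne u i hs]
        exact Ideal.mul_mem_right _ _ (X_mem_M i)
    have h4 : M K ≤ (M K).comap (quadHom u i) := by
      rw [M, Ideal.span_le]
      rintro x (rfl | rfl | rfl) <;> exact h3 _
    exact h4 h2
  rw [map_sub, quadHom_C, mem_M_iff, map_sub, constantCoeff_C, sub_eq_zero] at h1
  exact h1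

-- A single coefficient with `ord a_k = n - k` controls everything: its transform also has order `n
-- - k` and is not divisible by `X i`.
include h in
theorem smoothLocus_of_not_tangentConeIsPlane [CharZero K] (hF : HasWeierstrassCoeffs n a F)
    (hF₁ : HasWeierstrassCoeffs n b F₁)
    (hab : ∀ k < n - 1, quadHom u i (a k) = X i ^ (n - k) * b k)
    (hcone : ¬ TangentConeIsPlane F) :
    smoothLocus F₁ = insert (M K)
      {P | ∃ Q ∈ smoothLocus F, Q ≠ M K ∧ IsQuadraticTransformIdeal u i Q P} := by
  obtain ⟨k, hk, hak⟩ : ∃ k < n - 1, (a k).order = (n - k : ℕ) := by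
    by_contra! hne
    refine hcone (tangentConeIsPlane_of_lt_order hF fun k hk => ?_)
    have := lt_of_le_of_ne (hF.2.1 k hk).2 (hne k hk).symm
    rw [Nat.cast_add, Nat.cast_one]
    exact Order.add_one_le_of_lt this
  have hbk := coeff_ne_zero_of_quadHom_eq h (hF.2.1 k hk).1 hak (hab k hk) (hF₁.2.1 k hk).2
  have hbXY := (hF₁.2.1 k hk).1
  have hb0 : b k ≠ 0 := by
    intro e
    rw [e, map_zero] at hbk
    exact hbk rfl
  have hnk : 1 ≤ n - k := by omega
  ext P
  rw [Set.mem_insert_iff, Set.mem_ofPred_eq]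
  constructor
  · intro hP
    by_cases hM : P = M K
    · exact Or.inl hM
    right
    obtain ⟨hp, hZ, hs⟩ := hF₁.mem_equimultipleLocus_iff.mp hP.1
    have hbP : b k ∈ P := by
      have := symbolicPower_antitone hnk (hs k hk)
      rwa [symbolicPower_one] at this
    obtain ⟨H, hH, hH0, hHl, rfl⟩ := exists_eq_span_pair hp hP.2
      (ringKrullDim_quotient_le_one hZ hbXY hb0 hbP) hZ hM
    have hHne : H ≠ 0 := by
      rintro rfl
      simp [HasLinearPart] at hHl
    have hHi : ¬ X i ∣ H := by
      intro hd
      have h1 := hd.trans ((dvd_pow_self H (by omega)).trans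
        ((hF₁.pow_dvd hH hHne hP.1).2 k hk))
      exact hbk (X_dvd_iff.mp h1 _ (h.xyExp_fst _ _))
    obtain ⟨m, G, hm1, hG, hG0, hGord, -, hGm, -, hGd, hQ⟩ :=
      exists_blowDown_of_mem h hF hF₁ hab hH hHi hP.1
    -- `G ^ (n - k)` divides `a k`, so `(n - k) * m ≤ n - k`.
    have hm : m = 1 := by
      obtain ⟨e, he⟩ := hGd k hk
      have h1 : (n - k) • G.order ≤ (a k).order := by
        rw [he, order_mul]
        exact (le_order_pow _).trans le_self_add
      rw [hGord, hak, nsmul_eq_mul] at h1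
      have h2 : (n - k) * m ≤ n - k := by exact_mod_cast h1
      nlinarith
    rw [hm] at hGord
    have hGl := hasLinearPart_of_order_eq_one hG (by simpa using hGord)
    refine ⟨_, hF.mem_smoothLocus_of_dvd hG hG0 hGl hGd, fun e => ?_, hQ⟩
    exact not_isCurve_M (e ▸ (smooth_span_pair hG hG0 hGl).2.2)
  · rintro (rfl | ⟨Q, hQ, -, hQP⟩)
    · exact hF₁.M_mem_smoothLocus
    obtain ⟨s, G, G₁, hs1, hG, hG₁, hG0, hGs, rfl, rfl, hπ, hGd, hG₁d⟩ :=
      exists_generator_of_isQuadraticTransformIdeal h hF hab hQ.1 hQP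
    obtain ⟨e, he⟩ := hGd k hk
    have hle : ((n - k : ℕ) : ℕ∞) * s + e.order ≤ (n - k : ℕ) := by
      rw [← hGs, ← nsmul_eq_mul]
      refine (add_le_add_left (le_order_pow _) _).trans ?_
      rw [← order_mul, ← he, hak]
    have hs : s = 1 := by
      have h1 : (n - k) * s ≤ n - k := by exact_mod_cast le_self_add.trans hle
      nlinarith
    subst hs
    -- The orders of `G ^ (n - k)` and `a k` already agree, so the cofactor `e` is a unit. Thus `b
    -- k` is `G₁ ^ (n - k)` up to a unit, and `G₁` inherits order one from it.
    have he0 : constantCoeff e ≠ 0 := by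
      intro e0
      have h1 := (add_le_add_right (one_le_order_iff_constCoeff_eq_zero.mpr e0) _).trans hle
      have h2 : (n - k) * 1 + 1 ≤ n - k := by exact_mod_cast h1
      omega
    have hbe : b k = G₁ ^ (n - k) * quadHom u i e := by
      refine mul_left_cancel₀ (pow_ne_zero (n - k) (var_ne_zero i)) ?_
      rw [← hab k hk, he, map_mul, map_pow, hπ, pow_one, mul_pow, mul_assoc]
    have hG₁0 : constantCoeff G₁ = 0 := by
      have h1 : constantCoeff (b k) = 0 := by
        rw [← one_le_order_iff_constCoeff_eq_zero]
        exact le_trans (by exact_mod_cast hnk) (hF₁.2.1 k hk).2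
      rw [hbe, map_mul, map_pow, constantCoeff_quadHom] at h1
      exact eq_zero_of_pow_eq_zero ((mul_eq_zero.mp h1).resolve_right he0)
    have hG₁l : G₁.order = 1 := by
      refine le_antisymm ?_ (one_le_order_iff_constCoeff_eq_zero.mpr hG₁0)
      have h1 : (n - k) • G₁.order ≤ (n - k : ℕ) := by
        refine ((le_order_pow _).trans le_self_add).trans
          ((order_mul (f := G₁ ^ (n - k)) (g := quadHom u i e)).symm.le.trans ?_)
        rw [← hbe]
        refine (order_le hbk).trans ?_
        rw [h.degree, h.xyExp_fst, h.xyExp_snd, h.xyExp_two]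
        simp
      obtain ⟨t, ht⟩ := ENat.ne_top_iff_exists.mp (show G₁.order ≠ ⊤ from fun e => by
        rw [order_eq_top_iff] at e
        rw [hbe, e, zero_pow (by omega), zero_mul] at hb0
        exact hb0 rfl)
      rw [← ht, nsmul_eq_mul] at h1
      rw [← ht]
      have h2 : (n - k) * t ≤ n - k := by exact_mod_cast h1
      have h3 : t ≤ 1 := by nlinarith
      exact_mod_cast h3
    exact hF₁.mem_smoothLocus_of_dvd hG₁ hG₁0 (hasLinearPart_of_order_eq_one hG₁ hG₁l)
      fun k hk => (dvd_mul_left _ _).trans (hG₁d k hk)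

-- For a curve other than the exceptional one, the intersection number `m` of `H` with the
-- exceptional divisor decides the type: three if `m = 1`, two if `m ≥ 2`.
include h in
theorem curves_of_quadraticTransform [CharZero K] (hF : HasWeierstrassCoeffs n a F)
    (hF₁ : HasWeierstrassCoeffs n b F₁)
    (hab : ∀ k < n - 1, quadHom u i (a k) = X i ^ (n - k) * b k) :
    ∀ P ∈ smoothLocus F₁, IsCurve P →
      P = exceptionalCurve i ∨ IsTypeTwo u i F P ∨ IsTypeThree u i F P := by
  intro P hP hcurve
  obtain ⟨hp, hZ, -⟩ := hF₁.mem_equimultipleLocus_iff.mp hP.1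
  obtain ⟨H, hH, hH0, hHl, rfl⟩ := exists_eq_span_pair hp hP.2 hcurve.le hZ
    (fun e => not_isCurve_M (e ▸ hcurve))
  by_cases hHi : X i ∣ H
  · left
    rw [exceptionalCurve, span_pair_congr (associated_X_of_dvd h hHi hHl)]
  right
  obtain ⟨m, G, hm1, hG, hG0, hGord, hHm, hGm, hE, hGd, hQ⟩ :=
    exists_blowDown_of_mem h hF hF₁ hab hH hHi hP.1
  rw [isRegularOfOrder_restrict_iff] at hHm hGm
  rcases Nat.eq_or_lt_of_le hm1 with rfl | hm
  · right
    rw [xyExp_zero_one] at hHm hGm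
    exact ⟨hp, (isTransversal_span_pair_iff h hH).mpr ⟨hH0, hHm.1⟩, _,
      hF.mem_smoothLocus_of_dvd hG hG0 ((hasLinearPart_iff h).mpr (Or.inr hGm.1)) hGd,
      (isTransversal_span_pair_iff h hG).mpr ⟨hG0, hGm.1⟩, hQ⟩
  · left
    have hj := hHm.2 1 hm
    rw [xyExp_zero_one] at hj
    have hi := ((hasLinearPart_iff h).mp hHl).resolve_right (not_not.mpr hj)
    refine ⟨hp, isTangent_span_pair h hH hH0 hi hj, _, ⟨hE, fun hs => ?_⟩, hQ⟩
    have hGne : G ≠ 0 := by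
      rintro rfl
      rw [map_zero] at hGm
      exact hGm.1 rfl
    -- If `(Z, G)` were regular, it would contain a series in `X, Y` with a linear part; but such a
    -- series is a multiple of `G`, whose order is `m ≥ 2`.
    obtain ⟨L, hL, hLXY, hLl⟩ := exists_mem_hasLinearPart hE.1 hs.2
      (ringKrullDim_quotient_le_one (X_two_mem_span_pair G) hG hGne (self_mem_span_pair G))
      (X_two_mem_span_pair G)
    obtain ⟨e, rfl⟩ := (hLXY.mem_span_pair_iff hG).mp hL
    have h1 := order_eq_one_of_hasLinearPart (by rw [map_mul, hG0, zero_mul]) hLl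
    rw [order_mul, hGord] at h1
    have h2 : (m : ℕ∞) ≤ 1 := h1 ▸ le_self_add
    have h3 : m ≤ 1 := by exact_mod_cast h2
    omega

lemma constantCoeff_eq_zero_of_isPrime {G : PS K} (hp : (Ideal.span {X 2, G}).IsPrime) :
    constantCoeff G = 0 :=
  mem_M_iff.mp (le_M hp.ne_top (self_mem_span_pair G))

include h in
theorem mem_smoothLocus_of_isTypeTwo [CharZero K] (hF : HasWeierstrassCoeffs n a F)
    (hF₁ : HasWeierstrassCoeffs n b F₁)
    (hab : ∀ k < n - 1, quadHom u i (a k) = X i ^ (n - k) * b k) {P : Ideal (PS K)}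
    (hP : IsTypeTwo u i F P) : P ∈ smoothLocus F₁ := by
  obtain ⟨hp, ht, Q, hQ, hQP⟩ := hP
  obtain ⟨s, G, G₁, -, -, hG₁, -, -, -, rfl, -, -, hd⟩ :=
    exists_generator_of_isQuadraticTransformIdeal h hF hab hQ.1 hQP
  have h0 := constantCoeff_eq_zero_of_isPrime hp
  exact hF₁.mem_smoothLocus_of_dvd hG₁ h0
    ((hasLinearPart_iff h).mpr (Or.inl (coeff_ne_zero_of_isTangent h0 h.2.1 ht)))
    fun k hk => (dvd_mul_left _ _).trans (hd k hk)

include h in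
theorem mem_smoothLocus_of_isTypeThree [CharZero K] (hF : HasWeierstrassCoeffs n a F)
    (hF₁ : HasWeierstrassCoeffs n b F₁)
    (hab : ∀ k < n - 1, quadHom u i (a k) = X i ^ (n - k) * b k) {P : Ideal (PS K)}
    (hP : IsTypeThree u i F P) : P ∈ smoothLocus F₁ := by
  obtain ⟨hp, ht, Q, hQ, -, hQP⟩ := hP
  obtain ⟨s, G, G₁, -, -, hG₁, -, -, -, rfl, -, -, hd⟩ :=
    exists_generator_of_isQuadraticTransformIdeal h hF hab hQ.1 hQP
  obtain ⟨h0, hj⟩ := (isTransversal_span_pair_iff h hG₁).mp ht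
  exact hF₁.mem_smoothLocus_of_dvd hG₁ h0 ((hasLinearPart_iff h).mpr (Or.inr hj))
    fun k hk => (dvd_mul_left _ _).trans (hd k hk)

-- As `Q` is singular, its generator has order `s ≥ 2`, so `(n - k) * (s - 1) ≥ n - k` factors `X i`
-- remain in the `k`-th coefficient.
include h in
theorem exceptionalCurve_mem_smoothLocus [CharZero K] (hF : HasWeierstrassCoeffs n a F)
    (hF₁ : HasWeierstrassCoeffs n b F₁)
    (hab : ∀ k < n - 1, quadHom u i (a k) = X i ^ (n - k) * b k) {P : Ideal (PS K)}
    (hP : IsTypeTwo u i F P) : exceptionalCurve i ∈ smoothLocus F₁ := by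
  obtain ⟨-, -, Q, ⟨hQ, hQs⟩, hQP⟩ := hP
  obtain ⟨s, G, G₁, hs1, hG, -, hG0, hGs, rfl, -, -, hGd, hd⟩ :=
    exists_generator_of_isQuadraticTransformIdeal h hF hab hQ hQP
  have hs : 2 ≤ s := by
    by_contra hlt
    obtain rfl : s = 1 := by omega
    exact hQs (hF.mem_smoothLocus_of_dvd hG hG0
      (hasLinearPart_of_order_eq_one hG (by simpa using hGs)) hGd)
  refine hF₁.mem_smoothLocus_of_dvd (inXY_X h.2.1) (by simp)
    ((hasLinearPart_iff h).mpr (Or.inl (by simp))) fun k hk => ?_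
  exact (pow_dvd_pow _ (Nat.le_mul_of_pos_right _ (by omega))).trans
    ((dvd_mul_right _ _).trans (hd k hk))

end QuadraticTransform

end AlgebroidSurface

open AlgebroidSurface in
theorem mainTheorem1 {K : Type*} [Field K] [IsAlgClosed K] [CharZero K]
    (n : ℕ) (F : PS K) (hF : IsWeierstrassEquation n F) :
    -- (a) monoidal transforms with center a permitted curve
    (∀ P ∈ smoothLocus F, IsCurve P →
      ∀ F₁ : PS K, IsMonoidalTransform P F F₁ → F₁.order = F.order →
        smoothLocus F₁ = smoothLocus F ∨ smoothLocus F₁ = smoothLocus F \ {P}) ∧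
    -- (b) quadratic transforms
    (∀ (u : Fin 3 → K) (i : Fin 3), u i ≠ 0 →
      ∀ F₁ : PS K, IsQuadraticTransform u i F F₁ → F₁.order = F.order →
        -- (b.1)
        (¬ TangentConeIsPlane F →
          smoothLocus F₁ = insert (M K)
            {P | ∃ Q ∈ smoothLocus F, Q ≠ M K ∧ IsQuadraticTransformIdeal u i Q P}) ∧
        -- (b.2)
        (TangentConeIsPlane F →
          (∀ P ∈ smoothLocus F₁, IsCurve P →
            P = exceptionalCurve i ∨ IsTypeTwo u i F P ∨ IsTypeThree u i F P) ∧
          (∀ P : Ideal (PS K), IsTypeTwo u i F P ∨ IsTypeThree u i F P →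
            P ∈ smoothLocus F₁) ∧
          ((∃ P : Ideal (PS K), IsTypeTwo u i F P) →
            exceptionalCurve i ∈ smoothLocus F₁))) := by
  obtain ⟨a, ha⟩ := hF.exists_coeffs
  refine ⟨fun P hP hcurve F₁ hF₁ hord =>
    smoothLocus_of_isMonoidalTransform ha hP hcurve hF₁ hord, fun u i _ F₁ hF₁ hord => ?_⟩
  obtain ⟨j, h⟩ : ∃ j, IsXYPair i j := by
    fin_cases i
    · exact ⟨1, isXYPair_zero_one⟩
    · exact ⟨0, isXYPair_zero_one.symm⟩
    · exact (not_isQuadraticTransform_two ha hF₁ (hord.trans ha.order_eq).ge).elim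
  obtain ⟨b, hb, hab⟩ := hF₁.exists_coeffs h ha hord
  refine ⟨smoothLocus_of_not_tangentConeIsPlane h ha hb hab, fun _ =>
    ⟨curves_of_quadraticTransform h ha hb hab, ?_, ?_⟩⟩
  · rintro P (hP | hP)
    · exact mem_smoothLocus_of_isTypeTwo h ha hb hab hP
    · exact mem_smoothLocus_of_isTypeThree h ha hb hab hP
  · rintro ⟨P, hP⟩
    exact exceptionalCurve_mem_smoothLocus h ha hb hab hP
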